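/- THEOREM B1. Let $U\subset\mathbb R^N$ be a coordinate domain carrying a Riemannian metric tensor $a_{ij}(x)$, a 1-form $b_i(x)$ of unit Riemannian length, $a^{ij}b_ib_j=1$, and a scalar $g(x)$ with $-2<g(x)<2$ (all of class $C^1$, in particular smooth). Indices of $b$ are raised with $a^{ij}$, repeated indices are summed, and for a tangent vector $y$ put $$b=b_iy^i,\quad S^2=a_{ij}y^iy^j,\quad q=\sqrt{S^2-b^2},\quad h=\sqrt{1-\tfrac14g^2},\quad G=\frac gh,\quad B=b^2+gbq+q^2,\quad L=q+\tfrac g2b .$$ The Finsleroid–Finsler metric function is $K(x,y)=\sqrt B\,e^{-\frac12Gf}$, where $f=-\arctan\frac G2+\arctan\frac L{hb}$ for $b>0$ and $f=\pi-\arctan\frac G2+\arctan\frac L{hb}$ for $b<0$, with the common limit $f=-\arctan\frac G2+\frac\pi2$ on $b=0$. Let $$g_{ij}=\frac12\frac{\partial^2K^2}{\partial y^i\partial y^j},\qquad (g^{ij})=(g_{ij})^{-1},\qquad \gamma^k{}_{ij}=\frac12g^{kn}\Bigl(\frac{\partial g_{ni}}{\partial x^j}+\frac{\partial g_{nj}}{\partial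 x^i}-\frac{\partial g_{ji}}{\partial x^n}\Bigr),\qquad G^k=\gamma^k{}_{ij}y^iy^j .$$ Let $a^k{}_{ij}$ be the Christoffel symbols of $a_{ij}$, $\nabla_ib_j=\partial_ib_j-b_ka^k{}_{ij}$, $g_i=\partial g/\partial x^i$, $(yg)=y^ig_i$, $(ys)=y^hy^m\nabla_hb_m$, and $$r=-\frac gq,\qquad p=-br=\frac{gb}q,\qquad M=-\frac1{h^3}f+\frac12\frac G{hB}q^2+\frac1{h^2B}bq .$$ Then at every $x\in U$ and every $y$ with $q(x,y)>0$ (that is, $y$ not collinear with $b^i$) the function $K^2$ is smooth in $y$, the $g_{ij}$ are differentiable in $x$, $\det(g_{ij})\neq0$, and the spray coefficients are $$G^k=gq\bigl[a^{kj}+(pb^k+ry^k)b^j\bigr]y^h(\nabla_hb_j-\nabla_jb_h)+\frac gq(y^k-bb^k)(ys)+a^k{}_{mn}y^my^n+E^k,$$ where $$E^k=M(yg)y^k+\frac12K^2(yg)\frac{\partial M}{\partial y^h}g^{kh}-\frac12MK^2g_hg^{kh}.$$ Explicitly, if $g(x)\ne0$, then $$E^k=M(yg)y^k+K\frac{2q^2}{gNB}(yg)A^k-\frac12MK^2g_hg^{kh},$$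 where $A^k=g^{kj}A_j$, $A_k=g^{ij}A_{ijk}$ and $A_{ijk}=\frac K2\frac{\partial g_{ij}}{\partial y^k}$ is the Cartan tensor; and, for every value of $g(x)$, $$E^k=M(yg)y^k+\frac qB(yg)\bigl[Bb^k-(b+gq)y^k\bigr]-\frac12MK^2g_hg^{kh}.$$ -/

import Mathlib

noncomputable section

namespace FinslerLocal

/-- The partial derivative `∂F/∂zⁱ` at the point `z`. -/
def partialD {N : ℕ} (F : (Fin N → ℝ) → ℝ) (i : Fin N) (z : Fin N → ℝ) : ℝ :=
  lineDeriv ℝ F z (Pi.single i 1)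

/-! General Finsler notions of a metric function `K(x, y)` in local coordinates. -/

/-- The Finslerian metric tensor `g_{ij} = (1/2) ∂²K²/∂yⁱ∂yʲ`. -/
def metric {N : ℕ} (K : (Fin N → ℝ) → (Fin N → ℝ) → ℝ) (x y : Fin N → ℝ) :
    Matrix (Fin N) (Fin N) ℝ :=
  Matrix.of fun i j =>
    (1 / 2) * partialD (fun y' => partialD (fun y'' => K x y'' ^ 2) i y') j y

/-- The contravariant metric tensor `g^{ij}`, the inverse matrix of `g_{ij}`. -/
def metricInv {N : ℕ} (K : (Fin N → ℝ) → (Fin N → ℝ) → ℝ) (x y : Fin N → ℝ) :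
    Matrix (Fin N) (Fin N) ℝ :=
  (metric K x y)⁻¹

/-- The Finslerian Christoffel symbols
`γ^k_{ij} = (1/2) g^{kn} (∂g_{ni}/∂xʲ + ∂g_{nj}/∂xⁱ - ∂g_{ji}/∂xⁿ)`. -/
def christoffel {N : ℕ} (K : (Fin N → ℝ) → (Fin N → ℝ) → ℝ) (x y : Fin N → ℝ)
    (k i j : Fin N) : ℝ :=
  (1 / 2) * ∑ n, metricInv K x y k n *
    (partialD (fun x' => metric K x' y n i) j x
      + partialD (fun x' => metric K x' y n j) i x
      - partialD (fun x' => metric K x' y j i) n x)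

/-- The spray coefficients `G^k = γ^k_{ij} yⁱ yʲ`. -/
def spray {N : ℕ} (K : (Fin N → ℝ) → (Fin N → ℝ) → ℝ) (x y : Fin N → ℝ) (k : Fin N) : ℝ :=
  ∑ i, ∑ j, christoffel K x y k i j * y i * y j

/-- The Cartan tensor `A_{ijk} = (K/2) ∂g_{ij}/∂yᵏ`. -/
def cartan {N : ℕ} (K : (Fin N → ℝ) → (Fin N → ℝ) → ℝ) (x y : Fin N → ℝ)
    (i j k : Fin N) : ℝ :=
  K x y / 2 * partialD (fun y' => metric K x y' i j) k y

/-- The covariant Cartan vector `A_k = g^{ij} A_{ijk}`. -/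
def cartanLow {N : ℕ} (K : (Fin N → ℝ) → (Fin N → ℝ) → ℝ) (x y : Fin N → ℝ)
    (k : Fin N) : ℝ :=
  ∑ i, ∑ j, metricInv K x y i j * cartan K x y i j k

/-- The contravariant Cartan vector `A^k = g^{kj} A_j`. -/
def cartanUp {N : ℕ} (K : (Fin N → ℝ) → (Fin N → ℝ) → ℝ) (x y : Fin N → ℝ)
    (k : Fin N) : ℝ :=
  ∑ j, metricInv K x y k j * cartanLow K x y j

end FinslerLocal

/-- The data of a Finsleroid–Finsler space over a coordinate domain `U` of dimension `N`:
a Riemannian metric `a_{ij}(x)`, a 1-form `b_i(x)` of unit Riemannian length, and a scalar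
`g(x)` (the Finsleroid charge) with values in `(-2, 2)`, all of class `C¹`. -/
structure FinsleroidSpace (N : ℕ) where
  /-- the coordinate domain -/
  U : Set (Fin N → ℝ)
  isOpen_U : IsOpen U
  /-- the Riemannian metric tensor `a_{ij}` -/
  a : (Fin N → ℝ) → Matrix (Fin N) (Fin N) ℝ
  /-- the components `b_i` of the 1-form -/
  b : (Fin N → ℝ) → Fin N → ℝ
  /-- the Finsleroid charge -/
  g : (Fin N → ℝ) → ℝ
  a_regular : ∀ i j, ContDiffOn ℝ 1 (fun x => a x i j) U
  b_regular : ∀ i, ContDiffOn ℝ 1 (fun x => b x i) U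
  g_regular : ContDiffOn ℝ 1 g U
  a_posDef : ∀ x ∈ U, (a x).PosDef
  b_unit : ∀ x ∈ U, ∑ i, ∑ j, (a x)⁻¹ i j * b x i * b x j = 1
  g_range : ∀ x ∈ U, -2 < g x ∧ g x < 2

namespace FinsleroidSpace

open FinslerLocal

variable {N : ℕ} (F : FinsleroidSpace N)

/-! Objects of the associated Riemannian space. -/

/-- The contravariant Riemannian metric tensor `a^{ij}`. -/
def aInv (x : Fin N → ℝ) : Matrix (Fin N) (Fin N) ℝ := (F.a x)⁻¹

/-- The vector `b^i = a^{ij} b_j`. -/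
def bUp (x : Fin N → ℝ) (i : Fin N) : ℝ := ∑ j, F.aInv x i j * F.b x j

/-- The Riemannian Christoffel symbols
`a^k_{ij} = (1/2) a^{kn} (∂_j a_{ni} + ∂_i a_{nj} - ∂_n a_{ji})`. -/
def aChristoffel (x : Fin N → ℝ) (k i j : Fin N) : ℝ :=
  (1 / 2) * ∑ n, F.aInv x k n *
    (partialD (fun x' => F.a x' n i) j x
      + partialD (fun x' => F.a x' n j) i x
      - partialD (fun x' => F.a x' j i) n x)

/-- The Riemannian covariant derivative `∇_i b_j = ∂_i b_j - b_k a^k_{ij}`. -/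
def nablaB (x : Fin N → ℝ) (i j : Fin N) : ℝ :=
  partialD (fun x' => F.b x' j) i x - ∑ k, F.b x k * F.aChristoffel x k i j

/-- The gradient `g_i = ∂g/∂xⁱ` of the charge. -/
def gradG (x : Fin N → ℝ) (i : Fin N) : ℝ := partialD F.g i x

/-! The Finsleroid–Finsler metric function. -/

/-- The squared Riemannian length `S² = a_{ij} yⁱ yʲ`. -/
def Ssq (x y : Fin N → ℝ) : ℝ := ∑ i, ∑ j, F.a x i j * y i * y j

/-- The 1-form `b = b_i yⁱ` as a function of `(x, y)`. -/
def β (x y : Fin N → ℝ) : ℝ := ∑ i, F.b x i * y i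

/-- `q = √(S² - b²)`. -/
def q (x y : Fin N → ℝ) : ℝ := √(F.Ssq x y - F.β x y ^ 2)

/-- `h = √(1 - g²/4)`. -/
def h (x : Fin N → ℝ) : ℝ := √(1 - F.g x ^ 2 / 4)

/-- `G = g/h`. -/
def G (x : Fin N → ℝ) : ℝ := F.g x / F.h x

/-- The Finsleroid-characteristic quadratic form `B = b² + g b q + q²`. -/
def B (x y : Fin N → ℝ) : ℝ := F.β x y ^ 2 + F.g x * F.β x y * F.q x y + F.q x y ^ 2

/-- `L = q + (g/2) b`. -/
def L (x y : Fin N → ℝ) : ℝ := F.q x y + F.g x / 2 * F.β x y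

/-- The angle function `f`: it is `-arctan (G/2) + arctan (L/(h b))` for `b > 0` and
`π - arctan (G/2) + arctan (L/(h b))` for `b < 0`; on `b = 0` (where `L = q > 0` when `y ≠ 0`) both
expressions have the common limit `-arctan (G/2) + π/2`. -/
def f (x y : Fin N → ℝ) : ℝ :=
  if 0 < F.β x y then
    -Real.arctan (F.G x / 2) + Real.arctan (F.L x y / (F.h x * F.β x y))
  else if F.β x y < 0 then
    Real.pi - Real.arctan (F.G x / 2) + Real.arctan (F.L x y / (F.h x * F.β x y))
  else
    -Real.arctan (F.G x / 2) + Real.pi / 2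

/-- `J = exp (-(1/2) G f)`. -/
def J (x y : Fin N → ℝ) : ℝ := Real.exp (-(1 / 2) * F.G x * F.f x y)

/-- The Finsleroid–Finsler metric function `K = √B J`. -/
def K (x y : Fin N → ℝ) : ℝ := √(F.B x y) * F.J x y

/-! Ingredients of the spray coefficients. -/

/-- `r = -g/q`, which is `-g/(b w)` with `w = q/b`. -/
def r (x y : Fin N → ℝ) : ℝ := -F.g x / F.q x y

/-- `p = -b r`. -/
def p (x y : Fin N → ℝ) : ℝ := -F.β x y * F.r x y

/-- `s_k = yᵐ ∇_k b_m`. -/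
def s (x y : Fin N → ℝ) (k : Fin N) : ℝ := ∑ m, y m * F.nablaB x k m

/-- `(ys) = yʰ s_h`. -/
def ys (x y : Fin N → ℝ) : ℝ := ∑ i, y i * F.s x y i

/-- `(yg) = yⁱ g_i`. -/
def yg (x y : Fin N → ℝ) : ℝ := ∑ i, y i * F.gradG x i

/-- The scalar `M = -f/h³ + (1/2) (G/(h B)) q² + b q/(h² B)`. -/
def M (x y : Fin N → ℝ) : ℝ :=
  -(1 / F.h x ^ 3) * F.f x y + 1 / 2 * (F.G x / (F.h x * F.B x y)) * F.q x y ^ 2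
    + 1 / (F.h x ^ 2 * F.B x y) * F.β x y * F.q x y

/-- The contraction `g_h g^{kh}` of the gradient of the charge. -/
def gradGUp (x y : Fin N → ℝ) (k : Fin N) : ℝ := ∑ i, F.gradG x i * metricInv F.K x y k i

/-- The vector `E^k = M (yg) y^k + (1/2) K² (yg) (∂M/∂yʰ) g^{kh} - (1/2) M K² g_h g^{kh}`. -/
def E (x y : Fin N → ℝ) (k : Fin N) : ℝ :=
  F.M x y * F.yg x y * y k
    + 1 / 2 * F.K x y ^ 2 * F.yg x y *
        ∑ i, partialD (fun y' => F.M x y') i y * metricInv F.K x y k i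
    - 1 / 2 * F.M x y * F.K x y ^ 2 * F.gradGUp x y k

end FinsleroidSpace

end

/-!
On the region `q > 0` the three branches of the angle `f` are one smooth function,
`f = π / 2 - arctan ((b + g q / 2) / (h q))` (`angle_eq_branches`), so that `K² = W B` is a smooth
function of the three scalars `g`, `b`, `q`, where `W = exp (-G f)`. Its differential is very
simple: `dK² = W (2 (b + g q) db + 2 q dq) + M K² dg` (`hasDerivAt_conf_mul_quad`); this is where
`M` comes from.

Two fibre derivatives give `½ ∂K²/∂yⁱ = W (u_i + g q b_i)` and show that `g_{ij}` is `W` times a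
perturbation of `a_{ij}` in the plane spanned by `b_i` and `v_i = u_i - b b_i`, where
`u_i = a_{ij} yʲ` (`metric_eq`). Inverting it amounts to inverting a `2 × 2` matrix of determinant
one (`metricForm_mul_metricInvForm`).

For any metric tensor the contraction `γ^k_{ij} yⁱ yʲ` is `g^{kn}` applied to the Euler–Lagrange
covector `yʲ ∂_j (g_{ni} yⁱ) - ½ ∂_n (g_{ij} yⁱ yʲ)` with `y` kept fixed (`sum_christoffel`). For the
Finsleroid metric the two functions to be differentiated are `W (u_n + g q b_n)` and `K²`; for the
Riemannian metric they are `u_n` and `S²`. So no derivative of the full tensor `g_{ij}` with respect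
to `x` is ever computed. The derivatives of `b` are expressed through `(ys)`, the contracted curl of
`b_i` and the Riemannian contraction `a^k_{mn} y^m yⁿ` (`lineDeriv_β`, `lineDeriv_b`), and the
asserted spray is verified after its index has been lowered (`spray_eq`), where it is an identity
between scalar coefficients of `b_n`, `v_n`, the curl and the gradient of `g`.

As `M` is constant along rays, its fibre gradient is a multiple of `q² b_i - b v_i`
(`partialD_M`). So is the Cartan covector: the trace `g^{ij} ∂g_{ij}/∂yᵏ` is `N` times the
logarithmic derivative of `W` (`sum_metricInv_mul_partialD`). Raising the index of `q² b_i - b v_i`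
(`metricInv_mulVec_fibreDirection`) yields the two explicit forms of `E`.
-/

noncomputable section

namespace Finsleroid

open Real Filter Topology FinslerLocal Matrix

/-! ### The Finsleroid functions of the three scalars `g`, `b`, `q` -/

/-- The scalar `h = √(1 - g²/4)`. -/
def height (γ : ℝ) : ℝ := √(1 - γ ^ 2 / 4)

/-- The quadratic form `B = b² + g b q + q²`. -/
def quad (γ β κ : ℝ) : ℝ := β ^ 2 + γ * β * κ + κ ^ 2

/-- The angle `f`, in the branch-free form valid for `q > 0`. -/
def angle (γ β κ : ℝ) : ℝ := π / 2 - arctan ((β + γ / 2 * κ) / (height γ * κ))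

/-- The conformal factor `W = J² = exp (-G f)`. -/
def conf (γ β κ : ℝ) : ℝ := exp (-(γ / height γ * angle γ β κ))

/-- The scalar `M`, which is the derivative of `log K²` with respect to the charge. -/
def chargeLogDeriv (γ β κ : ℝ) : ℝ :=
  -(1 / height γ ^ 3) * angle γ β κ + 1 / 2 * (γ / height γ / (height γ * quad γ β κ)) * κ ^ 2
    + 1 / (height γ ^ 2 * quad γ β κ) * β * κ

section Scalars

variable {γ β κ : ℝ}

theorem one_sub_sq_pos (hγ : -2 < γ ∧ γ < 2) : 0 < 1 - γ ^ 2 / 4 := by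
  nlinarith [hγ.1, hγ.2]

theorem height_pos (hγ : -2 < γ ∧ γ < 2) : 0 < height γ := sqrt_pos.2 (one_sub_sq_pos hγ)

theorem height_sq (hγ : -2 < γ ∧ γ < 2) : height γ ^ 2 = 1 - γ ^ 2 / 4 :=
  sq_sqrt (one_sub_sq_pos hγ).le

theorem quad_pos (hγ : -2 < γ ∧ γ < 2) (hκ : 0 < κ) : 0 < quad γ β κ := by
  have := one_sub_sq_pos hγ
  have h2 : quad γ β κ = (β + γ / 2 * κ) ^ 2 + (1 - γ ^ 2 / 4) * κ ^ 2 := by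
    unfold quad; ring
  rw [h2]; positivity

theorem conf_pos : 0 < conf γ β κ := exp_pos _

/-- The three branches of the angle function combine into a single arctangent: `f` is the
argument of `(b + g q / 2) + i h q`, which lies in the upper half-plane. -/
theorem angle_eq_branches (hγ : -2 < γ ∧ γ < 2) (hκ : 0 < κ) :
    (if 0 < β then -arctan (γ / height γ / 2) + arctan ((κ + γ / 2 * β) / (height γ * β))
      else if β < 0 then
        π - arctan (γ / height γ / 2) + arctan ((κ + γ / 2 * β) / (height γ * β))
      else -arctan (γ / height γ / 2) + π / 2) = angle γ β κ := by
  have hh := height_pos hγ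
  have hsq := height_sq hγ
  set h := height γ with hdef
  set P := (β + γ / 2 * κ) / (h * κ) with hP
  set C := γ / h / 2 with hC
  have hPC : P - C = β / (h * κ) := by rw [hP, hC]; field_simp; ring
  have hPC1 : 1 + C * P = (κ + γ / 2 * β) / (h ^ 2 * κ) := by
    rw [hP, hC]; field_simp; rw [hsq]; ring
  -- the cotangent of the difference of the two angles
  have key : β ≠ 0 → tan (π / 2 - (arctan P - arctan C)) = (κ + γ / 2 * β) / (h * β) := by
    intro hβ
    have c1 := (cos_arctan_pos P).ne'
    have c2 := (cos_arctan_pos C).ne'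
    have s1 : sin (arctan P) = P * cos (arctan P) := by
      rw [← tan_mul_cos c1, tan_arctan]
    have s2 : sin (arctan C) = C * cos (arctan C) := by
      rw [← tan_mul_cos c2, tan_arctan]
    rw [tan_eq_sin_div_cos, sin_pi_div_two_sub, cos_pi_div_two_sub, cos_sub, sin_sub, s1, s2]
    have e1 : cos (arctan P) * cos (arctan C) + P * cos (arctan P) * (C * cos (arctan C))
        = (1 + C * P) * (cos (arctan P) * cos (arctan C)) := by ring
    have e2 : P * cos (arctan P) * cos (arctan C) - cos (arctan P) * (C * cos (arctan C))
        = (P - C) * (cos (arctan P) * cos (arctan C)) := by ring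
    rw [e1, e2, mul_div_mul_right _ _ (mul_ne_zero c1 c2), hPC, hPC1]
    field_simp
  have b1 := arctan_lt_pi_div_two P
  have b2 := neg_pi_div_two_lt_arctan P
  have b3 := arctan_lt_pi_div_two C
  have b4 := neg_pi_div_two_lt_arctan C
  -- `P - C` has the sign of `b`, so the monotonicity of the arctangent places
  -- `π / 2 - arctan P + arctan C` in the principal interval, or in its translate by `π`
  unfold angle
  rw [← hdef, ← hP]
  rcases lt_trichotomy β 0 with hβ | hβ | hβ
  · rw [if_neg hβ.not_gt, if_pos hβ, ← key hβ.ne, ← tan_sub_pi, arctan_tan]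
    · ring
    · have : arctan P < arctan C := arctan_strictMono (by
        have : β / (h * κ) < 0 := div_neg_of_neg_of_pos hβ (by positivity)
        linarith)
      linarith
    · linarith
  · rw [if_neg (by simp [hβ]), if_neg (by simp [hβ])]
    have : P = C := by
      have : β / (h * κ) = 0 := by simp [hβ]
      linarith
    rw [this]; ring
  · rw [if_pos hβ, ← key hβ.ne', arctan_tan]
    · ring
    · linarith
    · have : arctan C < arctan P := arctan_strictMono (by
        have : 0 < β / (h * κ) := by positivity
        linarith)
      linarith

end Scalars

section Curves

variable {γ β κ : ℝ → ℝ} {γ' β' κ' t : ℝ}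

theorem hasDerivAt_height (hγ : HasDerivAt γ γ' t) (hr : -2 < γ t ∧ γ t < 2) :
    HasDerivAt (fun s => height (γ s)) (-(γ t * γ' / (4 * height (γ t)))) t := by
  have h0 := one_sub_sq_pos hr
  have h1 := (((hγ.pow 2).div_const 4).const_sub 1).sqrt h0.ne'
  refine h1.congr_deriv ?_
  have := (height_pos hr).ne'
  change _ / (2 * height (γ t)) = _
  push_cast
  field_simp

theorem hasDerivAt_quad (hγ : HasDerivAt γ γ' t) (hβ : HasDerivAt β β' t)
    (hκ : HasDerivAt κ κ' t) :
    HasDerivAt (fun s => quad (γ s) (β s) (κ s))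
      (2 * β t * β' + (γ' * β t * κ t + γ t * β' * κ t + γ t * β t * κ') + 2 * κ t * κ') t := by
  refine (((hβ.pow 2).add ((hγ.mul hβ).mul hκ)).add (hκ.pow 2)).congr_deriv ?_
  simp only [Pi.mul_apply]
  push_cast
  ring

/-- The differential of `f`. Its coefficients are rational in `g`, `h`, `b`, `q`, because
`1 + P² = B / (h q)²` for the argument `P` of the arctangent. -/
theorem hasDerivAt_angle (hγ : HasDerivAt γ γ' t) (hβ : HasDerivAt β β' t)
    (hκ : HasDerivAt κ κ' t) (hr : -2 < γ t ∧ γ t < 2) (hpos : 0 < κ t) :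
    HasDerivAt (fun s => angle (γ s) (β s) (κ s))
      (height (γ t) / quad (γ t) (β t) (κ t) * (β t * κ' - κ t * β')
        - κ t * (κ t + γ t / 2 * β t) / (2 * height (γ t) * quad (γ t) (β t) (κ t)) * γ') t := by
  have hh := height_pos hr
  have hsq := height_sq hr
  have hB : 0 < quad (γ t) (β t) (κ t) := quad_pos hr hpos
  have hden : height (γ t) * κ t ≠ 0 := by positivity
  have h1 := (((hβ.add ((hγ.div_const 2).mul hκ)).div ((hasDerivAt_height hγ hr).mul hκ)
    hden).arctan).const_sub (π / 2)
  refine h1.congr_deriv ?_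
  simp only [Pi.mul_apply, Pi.add_apply, Pi.div_apply]
  have hB' : 1 + ((β t + γ t / 2 * κ t) / (height (γ t) * κ t)) ^ 2
      = quad (γ t) (β t) (κ t) / (height (γ t) ^ 2 * κ t ^ 2) := by
    field_simp
    rw [hsq]; unfold quad; ring
  rw [hB']
  generalize quad (γ t) (β t) (κ t) = B at *
  generalize height (γ t) = h at *
  have h4 : γ t ^ 2 = 4 - 4 * h ^ 2 := by linarith
  field_simp
  ring_nf
  simp only [h4]
  ring

/-- The differential of `W = exp (-G f)`, with the charge coefficient expressed through `M`. -/
theorem hasDerivAt_conf (hγ : HasDerivAt γ γ' t) (hβ : HasDerivAt β β' t)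
    (hκ : HasDerivAt κ κ' t) (hr : -2 < γ t ∧ γ t < 2) (hpos : 0 < κ t) :
    HasDerivAt (fun s => conf (γ s) (β s) (κ s))
      (conf (γ t) (β t) (κ t) * (γ t / quad (γ t) (β t) (κ t) * (κ t * β' - β t * κ')
        + γ' * (chargeLogDeriv (γ t) (β t) (κ t) - β t * κ t / quad (γ t) (β t) (κ t)))) t := by
  have hh := height_pos hr
  have hsq := height_sq hr
  have hB : 0 < quad (γ t) (β t) (κ t) := quad_pos hr hpos
  have h1 := (((hγ.div (hasDerivAt_height hγ hr) hh.ne').mul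
    (hasDerivAt_angle hγ hβ hκ hr hpos)).neg).exp
  refine h1.congr_deriv ?_
  simp only [Pi.mul_apply, Pi.neg_apply, Pi.div_apply]
  change conf (γ t) (β t) (κ t) * _ = _
  congr 1
  unfold chargeLogDeriv
  generalize angle (γ t) (β t) (κ t) = f at *
  generalize quad (γ t) (β t) (κ t) = B at *
  generalize height (γ t) = h at *
  have h4 : γ t ^ 2 = 4 - 4 * h ^ 2 := by linarith
  field_simp
  ring_nf
  simp only [h4]
  ring

/-- The differential of `K² = W B`; in particular `∂K²/∂g = M K²`. -/
theorem hasDerivAt_conf_mul_quad (hγ : HasDerivAt γ γ' t) (hβ : HasDerivAt β β' t)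
    (hκ : HasDerivAt κ κ' t) (hr : -2 < γ t ∧ γ t < 2) (hpos : 0 < κ t) :
    HasDerivAt (fun s => conf (γ s) (β s) (κ s) * quad (γ s) (β s) (κ s))
      (conf (γ t) (β t) (κ t) * (2 * (β t + γ t * κ t) * β' + 2 * κ t * κ'
        + γ' * (chargeLogDeriv (γ t) (β t) (κ t) * quad (γ t) (β t) (κ t)))) t := by
  have hB : 0 < quad (γ t) (β t) (κ t) := quad_pos hr hpos
  refine ((hasDerivAt_conf hγ hβ hκ hr hpos).mul (hasDerivAt_quad hγ hβ hκ)).congr_deriv ?_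
  field_simp
  ring

/-- The scalar `M` depends on the fibre only through the angle: along a curve of constant charge
its derivative is a multiple of `q db - b dq`. -/
theorem hasDerivAt_chargeLogDeriv {γ : ℝ} (hβ : HasDerivAt β β' t)
    (hκ : HasDerivAt κ κ' t) (hr : -2 < γ ∧ γ < 2) (hpos : 0 < κ t) :
    HasDerivAt (fun s => chargeLogDeriv γ (β s) (κ s))
      (2 * κ t ^ 2 / quad γ (β t) (κ t) ^ 2 * (κ t * β' - β t * κ')) t := by
  have hh := height_pos hr
  have hsq := height_sq hr
  have hB : 0 < quad γ (β t) (κ t) := quad_pos hr hpos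
  have hf := hasDerivAt_angle (hasDerivAt_const t γ) hβ hκ hr hpos
  have hq := hasDerivAt_quad (hasDerivAt_const t γ) hβ hκ
  have e : (fun s => chargeLogDeriv γ (β s) (κ s)) =ᶠ[𝓝 t] fun s =>
      -(1 / height γ ^ 3) * angle γ (β s) (κ s)
        + (1 / height γ ^ 2) * ((γ / 2 * κ s ^ 2 + β s * κ s) / quad γ (β s) (κ s)) := by
    refine Eventually.of_forall fun s => ?_
    simp only [chargeLogDeriv]
    field_simp
    ring
  refine HasDerivAt.congr_of_eventuallyEq ?_ e
  refine ((hf.const_mul _).add (((((hκ.pow 2).const_mul (γ / 2)).add (hβ.mul hκ)).div hq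
    hB.ne').const_mul _)).congr_deriv ?_
  simp only [Pi.mul_apply, Pi.pow_apply, Pi.add_apply]
  have hBe : quad γ (β t) (κ t) = β t ^ 2 + γ * β t * κ t + κ t ^ 2 := rfl
  generalize quad γ (β t) (κ t) = B at *
  generalize height γ = h at *
  have h4 : h ^ 2 = 1 - γ ^ 2 / 4 := hsq
  field_simp
  have h44 : h ^ 4 = (1 - γ ^ 2 / 4) ^ 2 := by rw [← h4]; ring
  simp only [h4, h44, hBe]
  push_cast
  ring

end Curves

section Smooth

variable {V : Type*} [NormedAddCommGroup V] [NormedSpace ℝ V] {γ β κ : V → ℝ} {z : V}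
  {n : WithTop ℕ∞}

theorem contDiffAt_quad (hγ : ContDiffAt ℝ n γ z) (hβ : ContDiffAt ℝ n β z)
    (hκ : ContDiffAt ℝ n κ z) : ContDiffAt ℝ n (fun s => quad (γ s) (β s) (κ s)) z := by
  unfold quad; fun_prop

theorem contDiffAt_conf (hγ : ContDiffAt ℝ n γ z) (hβ : ContDiffAt ℝ n β z)
    (hκ : ContDiffAt ℝ n κ z) (hr : -2 < γ z ∧ γ z < 2) (hpos : 0 < κ z) :
    ContDiffAt ℝ n (fun s => conf (γ s) (β s) (κ s)) z := by
  have hh : ContDiffAt ℝ n (fun s => height (γ s)) z :=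
    ContDiffAt.sqrt (by fun_prop) (one_sub_sq_pos hr).ne'
  have hne := (height_pos hr).ne'
  have hP : ContDiffAt ℝ n
      (fun s => (β s + γ s / 2 * κ s) / (height (γ s) * κ s)) z :=
    ContDiffAt.div (by fun_prop) (hh.mul hκ) (mul_ne_zero hne hpos.ne')
  have ha : ContDiffAt ℝ n (fun s => angle (γ s) (β s) (κ s)) z :=
    contDiffAt_const.sub (contDiff_arctan.contDiffAt.comp z hP)
  exact ((hγ.div hh hne).mul ha).neg.exp

end Smooth

/-! ### Rank-two perturbations of a bilinear form -/

section Perturbed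

variable {ι : Type*}

/-- The form `A + c₁ b ⊗ b + c₂ (b ⊗ v + v ⊗ b) + c₃ v ⊗ v`. -/
def perturbed (A : Matrix ι ι ℝ) (b v : ι → ℝ) (c₁ c₂ c₃ : ℝ) : Matrix ι ι ℝ :=
  Matrix.of fun i j => A i j + c₁ * (b i * b j) + c₂ * (b i * v j + v i * b j) + c₃ * (v i * v j)

theorem perturbed_apply (A : Matrix ι ι ℝ) (b v : ι → ℝ) (c₁ c₂ c₃ : ℝ) (i j : ι) :
    perturbed A b v c₁ c₂ c₃ i j =
      A i j + c₁ * (b i * b j) + c₂ * (b i * v j + v i * b j) + c₃ * (v i * v j) := rfl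

variable [Fintype ι]

theorem perturbed_mulVec (A : Matrix ι ι ℝ) (b v : ι → ℝ) (c₁ c₂ c₃ : ℝ) (z : ι → ℝ) (i : ι) :
    (perturbed A b v c₁ c₂ c₃ *ᵥ z) i = (A *ᵥ z) i + (c₁ * (b ⬝ᵥ z) + c₂ * (v ⬝ᵥ z)) * b i
      + (c₂ * (b ⬝ᵥ z) + c₃ * (v ⬝ᵥ z)) * v i := by
  simp only [mulVec, dotProduct, perturbed_apply, Finset.mul_sum, Finset.sum_mul,
    ← Finset.sum_add_distrib]
  exact Finset.sum_congr rfl fun j _ => by ring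

/-- A perturbation in the plane spanned by `b` and `v` is inverted by inverting a `2 × 2` matrix:
the four scalar relations say that the coefficients of the product vanish. -/
theorem perturbed_mul_perturbed [DecidableEq ι] {A A' : Matrix ι ι ℝ} {b v b' v' : ι → ℝ}
    {c₁ c₂ c₃ d₁ d₂ d₃ k : ℝ} (hA : A * A' = 1) (hb : A *ᵥ b' = b) (hv : A *ᵥ v' = v)
    (hb' : b ᵥ* A' = b') (hv' : v ᵥ* A' = v')
    (hbb : b ⬝ᵥ b' = 1) (hbv : b ⬝ᵥ v' = 0) (hvb : v ⬝ᵥ b' = 0) (hvv : v ⬝ᵥ v' = k)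
    (h₁ : d₁ + c₁ + c₁ * d₁ + c₂ * k * d₂ = 0) (h₂ : d₂ + c₂ + c₁ * d₂ + c₂ * k * d₃ = 0)
    (h₃ : d₂ + c₂ + c₂ * d₁ + c₃ * k * d₂ = 0) (h₄ : d₃ + c₃ + c₂ * d₂ + c₃ * k * d₃ = 0) :
    perturbed A b v c₁ c₂ c₃ * perturbed A' b' v' d₁ d₂ d₃ = 1 := by
  -- the product is applied to a vector `z`; every term is then a combination of `z`, `b` and `v`
  refine Matrix.ext_of_mulVec_single fun l => ?_
  generalize (Pi.single l 1 : ι → ℝ) = z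
  rw [one_mulVec, ← mulVec_mulVec]
  set w := perturbed A' b' v' d₁ d₂ d₃ *ᵥ z with hw
  have e : w = A' *ᵥ z + (d₁ * (b' ⬝ᵥ z) + d₂ * (v' ⬝ᵥ z)) • b'
      + (d₂ * (b' ⬝ᵥ z) + d₃ * (v' ⬝ᵥ z)) • v' := by
    ext i; simp [hw, perturbed_mulVec]
  have e1 : A *ᵥ w = z + (d₁ * (b' ⬝ᵥ z) + d₂ * (v' ⬝ᵥ z)) • b
      + (d₂ * (b' ⬝ᵥ z) + d₃ * (v' ⬝ᵥ z)) • v := by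
    rw [e, mulVec_add, mulVec_add, mulVec_smul, mulVec_smul, mulVec_mulVec, hA, one_mulVec, hb, hv]
  have e2 : b ⬝ᵥ w = b' ⬝ᵥ z + (d₁ * (b' ⬝ᵥ z) + d₂ * (v' ⬝ᵥ z)) := by
    rw [e, dotProduct_add, dotProduct_add, dotProduct_smul, dotProduct_smul, dotProduct_mulVec,
      hb', hbb, hbv]
    simp
  have e3 : v ⬝ᵥ w = v' ⬝ᵥ z + (d₂ * (b' ⬝ᵥ z) + d₃ * (v' ⬝ᵥ z)) * k := by
    rw [e, dotProduct_add, dotProduct_add, dotProduct_smul, dotProduct_smul, dotProduct_mulVec,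
      hv', hvb, hvv]
    simp
  ext i
  rw [perturbed_mulVec, e1, e2, e3]
  simp only [Pi.add_apply, Pi.smul_apply, smul_eq_mul]
  linear_combination ((b' ⬝ᵥ z) * b i) * h₁ + ((v' ⬝ᵥ z) * b i) * h₂ + ((b' ⬝ᵥ z) * v i) * h₃
    + ((v' ⬝ᵥ z) * v i) * h₄

end Perturbed

/-! ### Directional derivatives and the geodesic operator -/

section LineDeriv

variable {V : Type*} [AddCommGroup V] [Module ℝ V] {z d : V} {γ β κ σ : V → ℝ} {γ' β' κ' σ' : ℝ}

theorem hasLineDerivAt_const (c : ℝ) (z d : V) :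
    HasLineDerivAt ℝ (fun _ : V => c) 0 z d := hasDerivAt_const 0 c

theorem hasLineDerivAt_conf (hγ : HasLineDerivAt ℝ γ γ' z d) (hβ : HasLineDerivAt ℝ β β' z d)
    (hκ : HasLineDerivAt ℝ κ κ' z d) (hr : -2 < γ z ∧ γ z < 2) (hpos : 0 < κ z) :
    HasLineDerivAt ℝ (fun s => conf (γ s) (β s) (κ s))
      (conf (γ z) (β z) (κ z) * (γ z / quad (γ z) (β z) (κ z) * (κ z * β' - β z * κ')
        + γ' * (chargeLogDeriv (γ z) (β z) (κ z) - β z * κ z / quad (γ z) (β z) (κ z)))) z d := by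
  simpa only [HasLineDerivAt, zero_smul, add_zero] using
    hasDerivAt_conf (t := 0) hγ hβ hκ (by simpa using hr) (by simpa using hpos)

theorem hasLineDerivAt_quad (hγ : HasLineDerivAt ℝ γ γ' z d) (hβ : HasLineDerivAt ℝ β β' z d)
    (hκ : HasLineDerivAt ℝ κ κ' z d) :
    HasLineDerivAt ℝ (fun s => quad (γ s) (β s) (κ s))
      (2 * β z * β' + (γ' * β z * κ z + γ z * β' * κ z + γ z * β z * κ') + 2 * κ z * κ') z d := by
  simpa only [HasLineDerivAt, zero_smul, add_zero] using hasDerivAt_quad (t := 0) hγ hβ hκ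

theorem hasLineDerivAt_conf_mul_quad (hγ : HasLineDerivAt ℝ γ γ' z d)
    (hβ : HasLineDerivAt ℝ β β' z d) (hκ : HasLineDerivAt ℝ κ κ' z d)
    (hr : -2 < γ z ∧ γ z < 2) (hpos : 0 < κ z) :
    HasLineDerivAt ℝ (fun s => conf (γ s) (β s) (κ s) * quad (γ s) (β s) (κ s))
      (conf (γ z) (β z) (κ z) * (2 * (β z + γ z * κ z) * β' + 2 * κ z * κ'
        + γ' * (chargeLogDeriv (γ z) (β z) (κ z) * quad (γ z) (β z) (κ z)))) z d := by
  simpa only [HasLineDerivAt, zero_smul, add_zero] using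
    hasDerivAt_conf_mul_quad (t := 0) hγ hβ hκ (by simpa using hr) (by simpa using hpos)

theorem hasLineDerivAt_chargeLogDeriv {γ : ℝ} (hβ : HasLineDerivAt ℝ β β' z d)
    (hκ : HasLineDerivAt ℝ κ κ' z d) (hr : -2 < γ ∧ γ < 2) (hpos : 0 < κ z) :
    HasLineDerivAt ℝ (fun s => chargeLogDeriv γ (β s) (κ s))
      (2 * κ z ^ 2 / quad γ (β z) (κ z) ^ 2 * (κ z * β' - β z * κ')) z d := by
  simpa only [HasLineDerivAt, zero_smul, add_zero] using
    hasDerivAt_chargeLogDeriv (t := 0) hβ hκ hr (by simpa using hpos)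

/-- The differential of `q = √(S² - b²)`, both in the base and in the fibre. -/
theorem hasLineDerivAt_sqrt_sub_sq (hσ : HasLineDerivAt ℝ σ σ' z d)
    (hβ : HasLineDerivAt ℝ β β' z d) (hpos : 0 < √(σ z - β z ^ 2)) :
    HasLineDerivAt ℝ (fun s => √(σ s - β s ^ 2))
      ((σ' - 2 * β z * β') / (2 * √(σ z - β z ^ 2))) z d := by
  have h0 : σ z - β z ^ 2 ≠ 0 := (Real.sqrt_pos.1 hpos).ne'
  have h := (HasDerivAt.sub hσ (HasDerivAt.pow hβ 2)).sqrt (by simpa using h0)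
  simpa only [HasLineDerivAt, zero_smul, add_zero, Pi.sub_apply, Pi.pow_apply, Nat.cast_ofNat, pow_one,
    Nat.add_one_sub_one] using h

end LineDeriv

section PartialD

variable {N : ℕ} {φ : (Fin N → ℝ) → ℝ} {x d : Fin N → ℝ}

theorem _root_.ContDiffAt.hasLineDerivAt_one {φ : (Fin N → ℝ) → ℝ} (h : ContDiffAt ℝ 1 φ x)
    (d : Fin N → ℝ) : HasLineDerivAt ℝ φ (lineDeriv ℝ φ x d) x d :=
  (h.differentiableAt one_ne_zero).lineDifferentiableAt.hasLineDerivAt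

theorem lineDeriv_eq_sum_partialD (h : DifferentiableAt ℝ φ x) (d : Fin N → ℝ) :
    lineDeriv ℝ φ x d = ∑ i, d i * partialD φ i x := by
  simp only [partialD, h.lineDeriv_eq_fderiv]
  conv_lhs => rw [← Finset.univ_sum_single d]
  rw [map_sum]
  refine Finset.sum_congr rfl fun i _ => ?_
  rw [← smul_eq_mul, ← map_smul, ← Pi.single_smul, smul_eq_mul, mul_one]

theorem lineDeriv_sum {ι : Type*} (s : Finset ι) {φ : ι → (Fin N → ℝ) → ℝ}
    (h : ∀ i, DifferentiableAt ℝ (φ i) x) (c : ι → ℝ) :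
    lineDeriv ℝ (fun x' => ∑ i ∈ s, φ i x' * c i) x d = ∑ i ∈ s, lineDeriv ℝ (φ i) x d * c i := by
  refine HasLineDerivAt.lineDeriv ?_
  exact HasDerivAt.fun_sum fun i _ =>
    HasDerivAt.mul_const ((h i).lineDifferentiableAt.hasLineDerivAt) (c i)

theorem differentiableAt_mulVec {m : (Fin N → ℝ) → Matrix (Fin N) (Fin N) ℝ}
    (hm : ∀ i j, DifferentiableAt ℝ (fun x' => m x' i j) x) (y : Fin N → ℝ) (n : Fin N) :
    DifferentiableAt ℝ (fun x' => (m x' *ᵥ y) n) x := by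
  simp only [mulVec, dotProduct]
  fun_prop

/-- The quadratic contraction of the Christoffel symbols is a geodesic (Euler–Lagrange) operator:
only the covector `m_{ni} yⁱ` and the scalar `m_{ij} yⁱ yʲ` have to be differentiated. -/
theorem sum_christoffel {m : (Fin N → ℝ) → Matrix (Fin N) (Fin N) ℝ}
    (hm : ∀ i j, DifferentiableAt ℝ (fun x' => m x' i j) x) (w : Fin N → ℝ) (y : Fin N → ℝ) :
    ∑ i, ∑ j, ((1 / 2) * ∑ n, w n *
      (partialD (fun x' => m x' n i) j x + partialD (fun x' => m x' n j) i x
        - partialD (fun x' => m x' j i) n x)) * y i * y j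
    = w ⬝ᵥ fun n => lineDeriv ℝ (fun x' => (m x' *ᵥ y) n) x y
        - 1 / 2 * partialD (fun x' => (m x' *ᵥ y) ⬝ᵥ y) n x := by
  -- the first two Christoffel terms contract to the same covector
  have e1 : ∀ n, lineDeriv ℝ (fun x' => (m x' *ᵥ y) n) x y
      = ∑ i, ∑ j, partialD (fun x' => m x' n i) j x * y i * y j := by
    intro n
    simp only [mulVec, dotProduct]
    rw [lineDeriv_sum _ (fun i => hm n i)]
    refine Finset.sum_congr rfl fun i _ => ?_
    rw [lineDeriv_eq_sum_partialD (hm n i), Finset.sum_mul]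
    exact Finset.sum_congr rfl fun j _ => by ring
  have e1' : ∀ n, lineDeriv ℝ (fun x' => (m x' *ᵥ y) n) x y
      = ∑ i, ∑ j, partialD (fun x' => m x' n j) i x * y i * y j := by
    intro n
    rw [e1, Finset.sum_comm]
    exact Finset.sum_congr rfl fun j _ => Finset.sum_congr rfl fun j _ => by ring
  have e2 : ∀ n, partialD (fun x' => (m x' *ᵥ y) ⬝ᵥ y) n x
      = ∑ i, ∑ j, partialD (fun x' => m x' j i) n x * y i * y j := by
    intro n
    rw [Finset.sum_comm]
    simp only [partialD]
    change lineDeriv ℝ (fun x' => ∑ j, (m x' *ᵥ y) j * y j) x _ = _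
    rw [lineDeriv_sum _ (fun i => differentiableAt_mulVec hm y i)]
    refine Finset.sum_congr rfl fun j _ => ?_
    simp only [mulVec, dotProduct]
    rw [lineDeriv_sum _ (fun i => hm j i), Finset.sum_mul]
  have e3 : ∀ n, lineDeriv ℝ (fun x' => (m x' *ᵥ y) n) x y
        - 1 / 2 * partialD (fun x' => (m x' *ᵥ y) ⬝ᵥ y) n x
      = ∑ i, ∑ j, 1 / 2 * ((partialD (fun x' => m x' n i) j x
        + partialD (fun x' => m x' n j) i x - partialD (fun x' => m x' j i) n x) * y i * y j) := by
    intro n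
    have h1 := e1 n
    have h2 := e1' n
    simp only [add_mul, sub_mul, mul_add, mul_sub, Finset.sum_add_distrib, Finset.sum_sub_distrib,
      ← Finset.mul_sum]
    rw [← h1, ← h2, ← e2]
    ring
  simp only [e3]
  simp only [dotProduct, Finset.mul_sum, Finset.sum_mul]
  have swap : ∀ φ : Fin N → Fin N → Fin N → ℝ,
      ∑ i, ∑ j, ∑ n, φ i j n = ∑ n, ∑ i, ∑ j, φ i j n := fun φ => by
    rw [Finset.sum_comm (γ := Fin N) (f := fun n i => ∑ j, φ i j n)]
    exact Finset.sum_congr rfl fun i _ => Finset.sum_comm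
  rw [swap]
  refine Finset.sum_congr rfl fun n _ => Finset.sum_congr rfl fun i _ =>
    Finset.sum_congr rfl fun j _ => by ring

end PartialD

end Finsleroid

/-! ### The Finsleroid metric tensor -/

namespace FinsleroidSpace

open FinslerLocal Finsleroid Matrix Filter Topology

variable {N : ℕ} (F : FinsleroidSpace N) {x y : Fin N → ℝ}

/-- The Riemannian lowering `u_i = a_{ij} yʲ`. -/
def yLow (x y : Fin N → ℝ) : Fin N → ℝ := F.a x *ᵥ y

/-- The covector `v_i = u_i - b b_i`, the part of `u` orthogonal to `b_i`. -/
def vLow (x y : Fin N → ℝ) (i : Fin N) : ℝ := F.yLow x y i - F.β x y * F.b x i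

/-- The vector `vⁱ = yⁱ - b bⁱ`. -/
def vUp (x y : Fin N → ℝ) (i : Fin N) : ℝ := y i - F.β x y * F.bUp x i

theorem a_symm (hx : x ∈ F.U) (i j : Fin N) : F.a x i j = F.a x j i := by
  have := (F.a_posDef x hx).isHermitian.apply j i
  simpa using this

theorem a_transpose (hx : x ∈ F.U) : (F.a x)ᵀ = F.a x :=
  Matrix.ext fun i j => F.a_symm hx j i

theorem isUnit_det_a (hx : x ∈ F.U) : IsUnit (F.a x).det :=
  (F.a_posDef x hx).det_pos.ne'.isUnit

theorem a_mul_aInv (hx : x ∈ F.U) : F.a x * F.aInv x = 1 :=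
  Matrix.mul_nonsing_inv _ (F.isUnit_det_a hx)

theorem aInv_mul_a (hx : x ∈ F.U) : F.aInv x * F.a x = 1 :=
  Matrix.nonsing_inv_mul _ (F.isUnit_det_a hx)

theorem aInv_transpose (hx : x ∈ F.U) : (F.aInv x)ᵀ = F.aInv x := by
  rw [aInv, Matrix.transpose_nonsing_inv, F.a_transpose hx]

theorem bUp_eq (x : Fin N → ℝ) : F.bUp x = F.aInv x *ᵥ F.b x := rfl

theorem β_eq (x y : Fin N → ℝ) : F.β x y = F.b x ⬝ᵥ y := rfl

theorem a_mulVec_bUp (hx : x ∈ F.U) : F.a x *ᵥ F.bUp x = F.b x := by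
  rw [bUp_eq, mulVec_mulVec, F.a_mul_aInv hx, one_mulVec]

theorem vLow_eq (x y : Fin N → ℝ) : F.vLow x y = F.yLow x y - F.β x y • F.b x := rfl

theorem vUp_eq (x y : Fin N → ℝ) : F.vUp x y = y - F.β x y • F.bUp x := rfl

theorem a_mulVec_vUp (hx : x ∈ F.U) : F.a x *ᵥ F.vUp x y = F.vLow x y := by
  rw [vUp_eq, vLow_eq, mulVec_sub, mulVec_smul, F.a_mulVec_bUp hx, yLow]

/-- The unit length of the 1-form. -/
theorem b_dot_bUp (hx : x ∈ F.U) : F.b x ⬝ᵥ F.bUp x = 1 := by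
  rw [← F.b_unit x hx]
  simp only [dotProduct, bUp, aInv, Finset.mul_sum]
  exact Finset.sum_congr rfl fun i _ => Finset.sum_congr rfl fun j _ => by ring

theorem b_vecMul_aInv (hx : x ∈ F.U) : F.b x ᵥ* F.aInv x = F.bUp x := by
  rw [bUp_eq, ← F.aInv_transpose hx, vecMul_transpose, F.aInv_transpose hx]

theorem yLow_vecMul_aInv (hx : x ∈ F.U) : F.yLow x y ᵥ* F.aInv x = y := by
  rw [← F.aInv_transpose hx, vecMul_transpose, yLow, mulVec_mulVec, F.aInv_mul_a hx, one_mulVec]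

theorem vLow_vecMul_aInv (hx : x ∈ F.U) : F.vLow x y ᵥ* F.aInv x = F.vUp x y := by
  rw [vLow_eq, sub_vecMul, smul_vecMul, F.b_vecMul_aInv hx, F.yLow_vecMul_aInv hx, vUp_eq]

theorem b_dot_vUp (hx : x ∈ F.U) : F.b x ⬝ᵥ F.vUp x y = 0 := by
  rw [vUp_eq, dotProduct_sub, dotProduct_smul, F.b_dot_bUp hx, ← β_eq]; simp

theorem vLow_dot (x y z : Fin N → ℝ) :
    F.vLow x y ⬝ᵥ z = F.yLow x y ⬝ᵥ z - F.β x y * (F.b x ⬝ᵥ z) := by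
  rw [vLow_eq, sub_dotProduct, smul_dotProduct]; rfl

theorem yLow_dot_bUp (hx : x ∈ F.U) : F.yLow x y ⬝ᵥ F.bUp x = F.β x y := by
  rw [bUp_eq, dotProduct_mulVec, F.yLow_vecMul_aInv hx, dotProduct_comm, β_eq]

theorem vLow_dot_bUp (hx : x ∈ F.U) : F.vLow x y ⬝ᵥ F.bUp x = 0 := by
  rw [vLow_dot, F.yLow_dot_bUp hx, F.b_dot_bUp hx]; ring

theorem yLow_dot_self (x y : Fin N → ℝ) : F.yLow x y ⬝ᵥ y = F.Ssq x y := by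
  simp only [yLow, Ssq, dotProduct, mulVec, Finset.sum_mul]
  exact Finset.sum_congr rfl fun i _ => Finset.sum_congr rfl fun j _ => by ring

theorem Ssq_eq (hq : 0 < F.q x y) : F.Ssq x y = F.β x y ^ 2 + F.q x y ^ 2 := by
  have : 0 < F.Ssq x y - F.β x y ^ 2 := Real.sqrt_pos.1 hq
  rw [q, Real.sq_sqrt this.le]; ring

theorem vLow_dot_self (hq : 0 < F.q x y) : F.vLow x y ⬝ᵥ y = F.q x y ^ 2 := by
  rw [vLow_dot, F.yLow_dot_self, F.Ssq_eq hq, ← β_eq]; ring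

theorem vLow_dot_vUp (hx : x ∈ F.U) (hq : 0 < F.q x y) :
    F.vLow x y ⬝ᵥ F.vUp x y = F.q x y ^ 2 := by
  rw [vUp_eq, dotProduct_sub, dotProduct_smul, F.vLow_dot_bUp hx, F.vLow_dot_self hq]; simp

/-- The conformal factor `W = J²` as a function of `(x, y)`. -/
def W (x y : Fin N → ℝ) : ℝ := conf (F.g x) (F.β x y) (F.q x y)

theorem B_eq (x y : Fin N → ℝ) : F.B x y = quad (F.g x) (F.β x y) (F.q x y) := rfl

theorem B_pos (hx : x ∈ F.U) (hq : 0 < F.q x y) : 0 < F.B x y :=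
  quad_pos (F.g_range x hx) hq

theorem W_pos (x y : Fin N → ℝ) : 0 < F.W x y := conf_pos

/-- On `q > 0` the angle function has no branches. -/
theorem f_eq (hx : x ∈ F.U) (hq : 0 < F.q x y) :
    F.f x y = angle (F.g x) (F.β x y) (F.q x y) :=
  angle_eq_branches (F.g_range x hx) hq

theorem M_eq (hx : x ∈ F.U) (hq : 0 < F.q x y) :
    F.M x y = chargeLogDeriv (F.g x) (F.β x y) (F.q x y) := by
  rw [M, F.f_eq hx hq]; rfl

theorem K_sq (hx : x ∈ F.U) (hq : 0 < F.q x y) : F.K x y ^ 2 = F.W x y * F.B x y := by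
  rw [K, mul_pow, Real.sq_sqrt (F.B_pos hx hq).le, J, ← Real.exp_nat_mul, F.f_eq hx hq, W, conf]
  rw [mul_comm]
  congr 2
  simp only [G, h, height]
  push_cast
  ring

/-- The closed form of the metric tensor. -/
def metricForm (x y : Fin N → ℝ) : Matrix (Fin N) (Fin N) ℝ :=
  perturbed (F.a x) (F.b x) (F.vLow x y)
    (F.g x / F.B x y * (F.q x y * (F.β x y + F.g x * F.q x y)))
    (F.g x / F.B x y * F.q x y) (-(F.g x / F.B x y * (F.β x y / F.q x y)))

/-- The closed form of the inverse metric tensor. -/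
def metricInvForm (x y : Fin N → ℝ) : Matrix (Fin N) (Fin N) ℝ :=
  perturbed (F.aInv x) (F.bUp x) (F.vUp x y)
    (-(F.g x / F.B x y * (F.β x y * F.q x y)))
    (-(F.g x / F.B x y * F.q x y)) (F.g x / F.B x y * ((F.β x y + F.g x * F.q x y) / F.q x y))

theorem metricForm_mul_metricInvForm (hx : x ∈ F.U) (hq : 0 < F.q x y) :
    F.metricForm x y * F.metricInvForm x y = 1 := by
  have hB := (F.B_pos hx hq).ne'
  have hBe : F.B x y = F.β x y ^ 2 + F.g x * F.β x y * F.q x y + F.q x y ^ 2 := rfl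
  refine perturbed_mul_perturbed (k := F.q x y ^ 2) (F.a_mul_aInv hx) (F.a_mulVec_bUp hx)
    (F.a_mulVec_vUp hx) (F.b_vecMul_aInv hx) (F.vLow_vecMul_aInv hx) (F.b_dot_bUp hx)
    (F.b_dot_vUp hx) (F.vLow_dot_bUp hx) (F.vLow_dot_vUp hx hq) ?_ ?_ ?_ ?_
  all_goals
    generalize F.B x y = B at *
    generalize F.q x y = q at *
    field_simp
    rw [hBe]
    ring

/-! ### Fibre derivatives and the closed form of the metric tensor -/

theorem hasLineDerivAt_β_right (x y d : Fin N → ℝ) :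
    HasLineDerivAt ℝ (F.β x) (F.b x ⬝ᵥ d) y d := by
  have h : HasDerivAt (fun t : ℝ => F.β x y + t * (F.b x ⬝ᵥ d)) (1 * (F.b x ⬝ᵥ d)) 0 :=
    ((hasDerivAt_id (0 : ℝ)).mul_const _).const_add _
  rw [one_mul] at h
  refine h.congr_of_eventuallyEq (Eventually.of_forall fun t => ?_)
  simp only [β_eq, dotProduct_add, dotProduct_smul, smul_eq_mul]

theorem yLow_add_smul (x y d : Fin N → ℝ) (t : ℝ) :
    F.yLow x (y + t • d) = F.yLow x y + t • F.yLow x d := by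
  rw [yLow, mulVec_add, mulVec_smul]; rfl

theorem yLow_dot_comm (hx : x ∈ F.U) (y d : Fin N → ℝ) :
    F.yLow x y ⬝ᵥ d = F.yLow x d ⬝ᵥ y := by
  rw [yLow, yLow, dotProduct_comm, dotProduct_mulVec, ← mulVec_transpose, F.a_transpose hx]

theorem hasLineDerivAt_yLow_right (x y d : Fin N → ℝ) (i : Fin N) :
    HasLineDerivAt ℝ (fun y' => F.yLow x y' i) (F.yLow x d i) y d := by
  have h : HasDerivAt (fun t : ℝ => F.yLow x y i + t * F.yLow x d i) (1 * F.yLow x d i) 0 :=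
    ((hasDerivAt_id (0 : ℝ)).mul_const _).const_add _
  rw [one_mul] at h
  refine h.congr_of_eventuallyEq (Eventually.of_forall fun t => ?_)
  simp [yLow_add_smul]

theorem hasLineDerivAt_Ssq_right (hx : x ∈ F.U) (y d : Fin N → ℝ) :
    HasLineDerivAt ℝ (F.Ssq x) (2 * (F.yLow x y ⬝ᵥ d)) y d := by
  have h : HasDerivAt (fun t : ℝ => F.Ssq x y + t * (2 * (F.yLow x y ⬝ᵥ d))
      + t ^ 2 * F.Ssq x d) (1 * (2 * (F.yLow x y ⬝ᵥ d)) + (2 * (0 : ℝ) ^ 1 * 1) * F.Ssq x d) 0 :=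
    (((hasDerivAt_id (0 : ℝ)).mul_const _).const_add _).add
      (((hasDerivAt_id (0 : ℝ)).pow 2).mul_const _)
  simp only [pow_one, mul_zero, zero_mul, add_zero, one_mul] at h
  refine h.congr_of_eventuallyEq (Eventually.of_forall fun t => ?_)
  simp only [← yLow_dot_self, yLow_add_smul, dotProduct_add, add_dotProduct, smul_dotProduct,
    dotProduct_smul, smul_eq_mul, F.yLow_dot_comm hx d y]
  ring

theorem hasLineDerivAt_q_right (hx : x ∈ F.U) (hq : 0 < F.q x y) (d : Fin N → ℝ) :
    HasLineDerivAt ℝ (F.q x) (F.vLow x y ⬝ᵥ d / F.q x y) y d := by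
  have h := hasLineDerivAt_sqrt_sub_sq (F.hasLineDerivAt_Ssq_right hx y d)
    (F.hasLineDerivAt_β_right x y d) hq
  have e : (2 * (F.yLow x y ⬝ᵥ d) - 2 * F.β x y * (F.b x ⬝ᵥ d))
      / (2 * √(F.Ssq x y - F.β x y ^ 2)) = F.vLow x y ⬝ᵥ d / F.q x y := by
    rw [vLow_dot]
    change _ / (2 * F.q x y) = _
    field_simp
  rw [e] at h
  exact h

theorem contDiff_β_right {n : WithTop ℕ∞} (x : Fin N → ℝ) : ContDiff ℝ n (F.β x) := by
  unfold β; fun_prop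

theorem contDiff_Ssq_right {n : WithTop ℕ∞} (x : Fin N → ℝ) : ContDiff ℝ n (F.Ssq x) := by
  unfold Ssq; fun_prop

theorem contDiffAt_q_right {n : WithTop ℕ∞} (hq : 0 < F.q x y) : ContDiffAt ℝ n (F.q x) y :=
  ((F.contDiff_Ssq_right x).contDiffAt.sub ((F.contDiff_β_right x).contDiffAt.pow 2)).sqrt
    (Real.sqrt_pos.1 hq).ne'

theorem eventually_q_pos_right (hq : 0 < F.q x y) : ∀ᶠ y' in 𝓝 y, 0 < F.q x y' :=
  (F.contDiffAt_q_right (n := 0) hq).continuousAt.eventually (lt_mem_nhds hq)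

theorem contDiffAt_K_sq (hx : x ∈ F.U) (hq : 0 < F.q x y) {n : WithTop ℕ∞} :
    ContDiffAt ℝ n (fun y' => F.K x y' ^ 2) y := by
  have hβ := (F.contDiff_β_right (n := n) x).contDiffAt (x := y)
  have hκ := F.contDiffAt_q_right (n := n) hq
  have hγ : ContDiffAt ℝ n (fun _ : Fin N → ℝ => F.g x) y := contDiffAt_const
  refine ((contDiffAt_conf hγ hβ hκ (F.g_range x hx) hq).mul
    (contDiffAt_quad hγ hβ hκ)).congr_of_eventuallyEq ?_
  filter_upwards [F.eventually_q_pos_right hq] with y' hq'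
  exact F.K_sq hx hq'

theorem hasLineDerivAt_W_right (hx : x ∈ F.U) (hq : 0 < F.q x y) (d : Fin N → ℝ) :
    HasLineDerivAt ℝ (F.W x) (F.W x y * (F.g x / (F.q x y * F.B x y)
      * (F.q x y ^ 2 * (F.b x ⬝ᵥ d) - F.β x y * (F.vLow x y ⬝ᵥ d)))) y d := by
  have h := hasLineDerivAt_conf (hasLineDerivAt_const (F.g x) y d) (F.hasLineDerivAt_β_right x y d)
    (F.hasLineDerivAt_q_right hx hq d) (F.g_range x hx) hq
  have hB := (F.B_pos hx hq).ne'
  refine (congrArg (fun c => HasLineDerivAt ℝ (F.W x) c y d) ?_).mp h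
  change F.W x y * (F.g x / F.B x y * _ + _) = _
  field_simp
  ring

theorem partialD_K_sq (hx : x ∈ F.U) (hq : 0 < F.q x y) (i : Fin N) :
    partialD (fun y' => F.K x y' ^ 2) i y
      = 2 * (F.W x y * (F.yLow x y i + F.g x * F.q x y * F.b x i)) := by
  have h := hasLineDerivAt_conf_mul_quad (hasLineDerivAt_const (F.g x) y (Pi.single i 1))
    (F.hasLineDerivAt_β_right x y (Pi.single i 1))
    (F.hasLineDerivAt_q_right hx hq (Pi.single i 1)) (F.g_range x hx) hq
  have e : (fun y' => F.K x y' ^ 2) =ᶠ[𝓝 y] fun y' => F.W x y' * F.B x y' := by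
    filter_upwards [F.eventually_q_pos_right hq] with y' hq'
    exact F.K_sq hx hq'
  rw [partialD, e.lineDeriv_eq]
  refine h.lineDeriv.trans ?_
  simp only [dotProduct_single_one, vLow]
  change F.W x y * _ = _
  field_simp
  ring

theorem partialD_M (hx : x ∈ F.U) (hq : 0 < F.q x y) (i : Fin N) :
    partialD (fun y' => F.M x y') i y = 2 * F.q x y / F.B x y ^ 2
      * (F.q x y ^ 2 * F.b x i - F.β x y * F.vLow x y i) := by
  have h := hasLineDerivAt_chargeLogDeriv
    (F.hasLineDerivAt_β_right x y (Pi.single i 1))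
    (F.hasLineDerivAt_q_right hx hq (Pi.single i 1)) (F.g_range x hx) hq
  have e : (fun y' => F.M x y') =ᶠ[𝓝 y]
      fun y' => chargeLogDeriv (F.g x) (F.β x y') (F.q x y') := by
    filter_upwards [F.eventually_q_pos_right hq] with y' hq'
    exact F.M_eq hx hq'
  rw [partialD, e.lineDeriv_eq]
  refine h.lineDeriv.trans ?_
  have hB := (F.B_pos hx hq).ne'
  simp only [dotProduct_single_one]
  rw [← B_eq]
  field_simp

/-- The metric tensor is conformal to a perturbation of the Riemannian one. -/
theorem metric_eq (hx : x ∈ F.U) (hq : 0 < F.q x y) :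
    metric F.K x y = F.W x y • F.metricForm x y := by
  ext i j
  have e : (fun y' => partialD (fun y'' => F.K x y'' ^ 2) i y') =ᶠ[𝓝 y]
      fun y' => 2 * (F.W x y' * (F.yLow x y' i + F.g x * F.q x y' * F.b x i)) := by
    filter_upwards [F.eventually_q_pos_right hq] with y' hq'
    exact F.partialD_K_sq hx hq' i
  have h : HasLineDerivAt ℝ
      (fun y' => 2 * (F.W x y' * (F.yLow x y' i + F.g x * F.q x y' * F.b x i))) _ y
      (Pi.single j 1) :=
    ((HasDerivAt.mul (F.hasLineDerivAt_W_right hx hq (Pi.single j 1))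
      (HasDerivAt.add (F.hasLineDerivAt_yLow_right x y (Pi.single j 1) i)
        (((F.hasLineDerivAt_q_right hx hq (Pi.single j 1)).const_mul (F.g x)).mul_const
          (F.b x i)))).const_mul 2)
  have hB := (F.B_pos hx hq).ne'
  have hBe : F.B x y = F.β x y ^ 2 + F.g x * F.β x y * F.q x y + F.q x y ^ 2 := rfl
  have hu : F.yLow x y i = F.vLow x y i + F.β x y * F.b x i := by simp [vLow]
  rw [metric, Matrix.of_apply, partialD, e.lineDeriv_eq, h.lineDeriv, Matrix.smul_apply,
    metricForm, perturbed_apply]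
  have ha : F.yLow x (Pi.single j 1) i = F.a x i j := by simp [yLow]
  simp only [dotProduct_single_one, Pi.add_apply, zero_smul, add_zero, ha, hu, smul_eq_mul]
  generalize F.B x y = B at *
  field_simp
  rw [hBe]
  ring

theorem metric_mul (hx : x ∈ F.U) (hq : 0 < F.q x y) :
    metric F.K x y * ((F.W x y)⁻¹ • F.metricInvForm x y) = 1 := by
  rw [F.metric_eq hx hq, smul_mul_smul_comm, F.metricForm_mul_metricInvForm hx hq,
    mul_inv_cancel₀ (F.W_pos x y).ne', one_smul]

theorem metricInv_eq (hx : x ∈ F.U) (hq : 0 < F.q x y) :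
    metricInv F.K x y = (F.W x y)⁻¹ • F.metricInvForm x y :=
  Matrix.inv_eq_right_inv (F.metric_mul hx hq)

theorem isUnit_det_metric (hx : x ∈ F.U) (hq : 0 < F.q x y) :
    IsUnit (metric F.K x y).det :=
  (Matrix.isUnit_iff_isUnit_det _).1 (IsUnit.of_mul_eq_one _ (F.metric_mul hx hq))

theorem metricInv_mulVec_metric_mulVec (hx : x ∈ F.U) (hq : 0 < F.q x y) (z : Fin N → ℝ) :
    metricInv F.K x y *ᵥ (metric F.K x y *ᵥ z) = z := by
  rw [mulVec_mulVec, metricInv, Matrix.nonsing_inv_mul _ (F.isUnit_det_metric hx hq), one_mulVec]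

theorem metric_mulVec_metricInv_mulVec (hx : x ∈ F.U) (hq : 0 < F.q x y) (z : Fin N → ℝ) :
    metric F.K x y *ᵥ (metricInv F.K x y *ᵥ z) = z := by
  rw [mulVec_mulVec, metricInv, Matrix.mul_nonsing_inv _ (F.isUnit_det_metric hx hq), one_mulVec]

/-- Lowering an index with the Finsleroid metric tensor. -/
theorem metric_mulVec (hx : x ∈ F.U) (hq : 0 < F.q x y) (z : Fin N → ℝ) (i : Fin N) :
    (metric F.K x y *ᵥ z) i = F.W x y * ((F.a x *ᵥ z) i
      + F.g x / F.B x y * ((F.q x y * (F.β x y + F.g x * F.q x y) * (F.b x ⬝ᵥ z)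
          + F.q x y * (F.vLow x y ⬝ᵥ z)) * F.b x i
        + (F.q x y * (F.b x ⬝ᵥ z) - F.β x y / F.q x y * (F.vLow x y ⬝ᵥ z)) * F.vLow x y i)) := by
  rw [F.metric_eq hx hq, smul_mulVec, Pi.smul_apply, smul_eq_mul, metricForm, perturbed_mulVec]
  ring

/-- Euler's relation: `g_{ij} yʲ = ½ ∂K²/∂yⁱ`. -/
theorem metric_mulVec_self (hx : x ∈ F.U) (hq : 0 < F.q x y) (i : Fin N) :
    (metric F.K x y *ᵥ y) i = F.W x y * (F.yLow x y i + F.g x * F.q x y * F.b x i) := by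
  have hB := (F.B_pos hx hq).ne'
  have hBe : F.B x y = F.β x y ^ 2 + F.g x * F.β x y * F.q x y + F.q x y ^ 2 := rfl
  rw [F.metric_mulVec hx hq, F.vLow_dot_self hq, ← β_eq, yLow]
  generalize F.B x y = B at *
  field_simp
  rw [hBe]
  ring

/-- Euler's relation: `g_{ij} yⁱ yʲ = K²`. -/
theorem metric_mulVec_self_dot (hx : x ∈ F.U) (hq : 0 < F.q x y) :
    (metric F.K x y *ᵥ y) ⬝ᵥ y = F.W x y * F.B x y := by
  have : metric F.K x y *ᵥ y
      = F.W x y • (F.yLow x y + (F.g x * F.q x y) • F.b x) := by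
    ext i; simp [F.metric_mulVec_self hx hq]
  rw [this, smul_dotProduct, add_dotProduct, smul_dotProduct, F.yLow_dot_self, F.Ssq_eq hq,
    ← β_eq, B]
  simp only [smul_eq_mul]
  ring

/-! ### Base derivatives -/

theorem contDiffAt_a (hx : x ∈ F.U) (i j : Fin N) : ContDiffAt ℝ 1 (fun x' => F.a x' i j) x :=
  (F.a_regular i j).contDiffAt (F.isOpen_U.mem_nhds hx)

theorem contDiffAt_b (hx : x ∈ F.U) (i : Fin N) : ContDiffAt ℝ 1 (fun x' => F.b x' i) x :=
  (F.b_regular i).contDiffAt (F.isOpen_U.mem_nhds hx)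

theorem contDiffAt_g (hx : x ∈ F.U) : ContDiffAt ℝ 1 F.g x :=
  F.g_regular.contDiffAt (F.isOpen_U.mem_nhds hx)

theorem contDiffAt_β_left (hx : x ∈ F.U) (y : Fin N → ℝ) :
    ContDiffAt ℝ 1 (fun x' => F.β x' y) x :=
  ContDiffAt.sum fun i _ => (F.contDiffAt_b hx i).mul contDiffAt_const

theorem contDiffAt_yLow_left (hx : x ∈ F.U) (y : Fin N → ℝ) (i : Fin N) :
    ContDiffAt ℝ 1 (fun x' => F.yLow x' y i) x := by
  unfold yLow mulVec dotProduct
  exact ContDiffAt.sum fun j _ => (F.contDiffAt_a hx i j).mul contDiffAt_const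

theorem contDiffAt_Ssq_left (hx : x ∈ F.U) (y : Fin N → ℝ) :
    ContDiffAt ℝ 1 (fun x' => F.Ssq x' y) x :=
  ContDiffAt.sum fun i _ => ContDiffAt.sum fun j _ =>
    ((F.contDiffAt_a hx i j).mul contDiffAt_const).mul contDiffAt_const

theorem contDiffAt_q_left (hx : x ∈ F.U) (hq : 0 < F.q x y) :
    ContDiffAt ℝ 1 (fun x' => F.q x' y) x :=
  ((F.contDiffAt_Ssq_left hx y).sub ((F.contDiffAt_β_left hx y).pow 2)).sqrt
    (Real.sqrt_pos.1 hq).ne'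

theorem contDiffAt_W_left (hx : x ∈ F.U) (hq : 0 < F.q x y) :
    ContDiffAt ℝ 1 (fun x' => F.W x' y) x :=
  contDiffAt_conf (F.contDiffAt_g hx) (F.contDiffAt_β_left hx y) (F.contDiffAt_q_left hx hq)
    (F.g_range x hx) hq

theorem contDiffAt_B_left (hx : x ∈ F.U) (hq : 0 < F.q x y) :
    ContDiffAt ℝ 1 (fun x' => F.B x' y) x :=
  contDiffAt_quad (F.contDiffAt_g hx) (F.contDiffAt_β_left hx y) (F.contDiffAt_q_left hx hq)

theorem eventually_q_pos_left (hx : x ∈ F.U) (hq : 0 < F.q x y) :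
    ∀ᶠ x' in 𝓝 x, x' ∈ F.U ∧ 0 < F.q x' y :=
  (F.isOpen_U.eventually_mem hx).and
    ((F.contDiffAt_q_left hx hq).continuousAt.eventually (lt_mem_nhds hq))

theorem contDiffAt_metric_left (hx : x ∈ F.U) (hq : 0 < F.q x y) (i j : Fin N) :
    ContDiffAt ℝ 1 (fun x' => metric F.K x' y i j) x := by
  have hg := F.contDiffAt_g hx
  have hβ := F.contDiffAt_β_left hx y
  have hκ := F.contDiffAt_q_left hx hq
  have hW := F.contDiffAt_W_left hx hq
  have hb := F.contDiffAt_b hx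
  have hv : ∀ i, ContDiffAt ℝ 1 (fun x' => F.vLow x' y i) x := fun i =>
    (F.contDiffAt_yLow_left hx y i).sub (hβ.mul (hb i))
  have hgB : ContDiffAt ℝ 1 (fun x' => F.g x' / F.B x' y) x :=
    hg.div (F.contDiffAt_B_left hx hq) (F.B_pos hx hq).ne'
  have hβκ : ContDiffAt ℝ 1 (fun x' => F.β x' y / F.q x' y) x := hβ.div hκ hq.ne'
  have h : ContDiffAt ℝ 1 (fun x' => F.W x' y * F.metricForm x' y i j) x := by
    simp only [metricForm, perturbed_apply]
    exact hW.mul ((((F.contDiffAt_a hx i j).add ((hgB.mul (hκ.mul (hβ.add (hg.mul hκ)))).mul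
      ((hb i).mul (hb j)))).add ((hgB.mul hκ).mul (((hb i).mul (hv j)).add ((hv i).mul (hb j))))).add
      ((hgB.mul hβκ).neg.mul ((hv i).mul (hv j))))
  refine h.congr_of_eventuallyEq ?_
  filter_upwards [F.eventually_q_pos_left hx hq] with x' hx'
  rw [F.metric_eq hx'.1 hx'.2]; rfl

theorem hasLineDerivAt_q_left (hx : x ∈ F.U) (hq : 0 < F.q x y) (d : Fin N → ℝ) :
    HasLineDerivAt ℝ (fun x' => F.q x' y) ((lineDeriv ℝ (fun x' => F.Ssq x' y) x d
      - 2 * F.β x y * lineDeriv ℝ (fun x' => F.β x' y) x d) / (2 * F.q x y)) x d :=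
  hasLineDerivAt_sqrt_sub_sq ((F.contDiffAt_Ssq_left hx y).hasLineDerivAt_one d)
    ((F.contDiffAt_β_left hx y).hasLineDerivAt_one d) hq

/-- The base derivatives of `K²`, with `y` fixed; the charge contributes `M K² g_n`. -/
theorem partialD_metric_dot (hx : x ∈ F.U) (hq : 0 < F.q x y) (n : Fin N) :
    partialD (fun x' => (metric F.K x' y *ᵥ y) ⬝ᵥ y) n x
      = F.W x y * (2 * F.g x * F.q x y * partialD (fun x' => F.β x' y) n x
        + partialD (fun x' => F.Ssq x' y) n x + F.gradG x n * (F.M x y * F.B x y)) := by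
  have e : (fun x' => (metric F.K x' y *ᵥ y) ⬝ᵥ y) =ᶠ[𝓝 x] fun x' => F.W x' y * F.B x' y := by
    filter_upwards [F.eventually_q_pos_left hx hq] with x' hx'
    exact F.metric_mulVec_self_dot hx'.1 hx'.2
  have h := hasLineDerivAt_conf_mul_quad ((F.contDiffAt_g hx).hasLineDerivAt_one (Pi.single n 1))
    ((F.contDiffAt_β_left hx y).hasLineDerivAt_one (Pi.single n 1))
    (F.hasLineDerivAt_q_left hx hq (Pi.single n 1)) (F.g_range x hx) hq
  rw [partialD, e.lineDeriv_eq]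
  refine h.lineDeriv.trans ?_
  rw [← F.M_eq hx hq]
  change F.W x y * (_ + F.gradG x n * (_ * F.B x y)) = _
  simp only [partialD]
  field_simp
  ring

/-- The base derivatives of the covector `g_{nj} yʲ`, with `y` fixed. -/
theorem lineDeriv_metric_mulVec (hx : x ∈ F.U) (hq : 0 < F.q x y) (n : Fin N) (d : Fin N → ℝ) :
    lineDeriv ℝ (fun x' => (metric F.K x' y *ᵥ y) n) x d
      = F.W x y * ((F.g x / F.B x y * (F.q x y * lineDeriv ℝ (fun x' => F.β x' y) x d
            - F.β x y * ((lineDeriv ℝ (fun x' => F.Ssq x' y) x d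
              - 2 * F.β x y * lineDeriv ℝ (fun x' => F.β x' y) x d) / (2 * F.q x y)))
          + lineDeriv ℝ F.g x d * (F.M x y - F.β x y * F.q x y / F.B x y))
          * (F.yLow x y n + F.g x * F.q x y * F.b x n)
        + (lineDeriv ℝ (fun x' => F.yLow x' y n) x d
          + (lineDeriv ℝ F.g x d * F.q x y + F.g x * ((lineDeriv ℝ (fun x' => F.Ssq x' y) x d
              - 2 * F.β x y * lineDeriv ℝ (fun x' => F.β x' y) x d) / (2 * F.q x y))) * F.b x n
          + F.g x * F.q x y * lineDeriv ℝ (fun x' => F.b x' n) x d)) := by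
  have e : (fun x' => (metric F.K x' y *ᵥ y) n) =ᶠ[𝓝 x]
      fun x' => F.W x' y * (F.yLow x' y n + F.g x' * F.q x' y * F.b x' n) := by
    filter_upwards [F.eventually_q_pos_left hx hq] with x' hx'
    exact F.metric_mulVec_self hx'.1 hx'.2 n
  have hg := (F.contDiffAt_g hx).hasLineDerivAt_one d
  have hκ := F.hasLineDerivAt_q_left hx hq d
  have hW := hasLineDerivAt_conf hg ((F.contDiffAt_β_left hx y).hasLineDerivAt_one d)
    hκ (F.g_range x hx) hq
  rw [← F.M_eq hx hq] at hW
  have h : HasLineDerivAt ℝ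
      (fun x' => F.W x' y * (F.yLow x' y n + F.g x' * F.q x' y * F.b x' n)) _ x d :=
    HasDerivAt.mul hW (HasDerivAt.add ((F.contDiffAt_yLow_left hx y n).hasLineDerivAt_one d)
      (HasDerivAt.mul (HasDerivAt.mul hg hκ) ((F.contDiffAt_b hx n).hasLineDerivAt_one d)))
  rw [e.lineDeriv_eq, h.lineDeriv]
  simp only [zero_smul, add_zero]
  change F.W x y * _ * _ + F.W x y * _ = _
  rw [← B_eq]
  ring

/-! ### The Riemannian contractions -/

/-- The contraction `c^k = a^k_{mn} y^m yⁿ` of the Riemannian Christoffel symbols. -/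
def aSpray (x y : Fin N → ℝ) (k : Fin N) : ℝ := ∑ m, ∑ n, F.aChristoffel x k m n * y m * y n

/-- The contracted exterior derivative `ω_j = yⁱ (∇_i b_j - ∇_j b_i)`. -/
def curlB (x y : Fin N → ℝ) (j : Fin N) : ℝ := ∑ i, y i * (F.nablaB x i j - F.nablaB x j i)

/-- The Euler–Lagrange form of the Riemannian contraction `a^k_{mn} y^m yⁿ`. -/
theorem a_mulVec_aSpray (hx : x ∈ F.U) (n : Fin N) :
    (F.a x *ᵥ F.aSpray x y) n = lineDeriv ℝ (fun x' => F.yLow x' y n) x y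
      - 1 / 2 * partialD (fun x' => F.Ssq x' y) n x := by
  have h : F.aSpray x y = F.aInv x *ᵥ fun n => lineDeriv ℝ (fun x' => F.yLow x' y n) x y
      - 1 / 2 * partialD (fun x' => F.Ssq x' y) n x := by
    ext k
    have := sum_christoffel (m := F.a) (x := x)
      (fun i j => (F.contDiffAt_a hx i j).differentiableAt one_ne_zero) (F.aInv x k) y
    simp only [← yLow_dot_self]
    exact this
  rw [h, mulVec_mulVec, F.a_mul_aInv hx, one_mulVec]

theorem yLow_dot_aSpray (hx : x ∈ F.U) :
    F.yLow x y ⬝ᵥ F.aSpray x y = 1 / 2 * lineDeriv ℝ (fun x' => F.Ssq x' y) x y := by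
  have h1 : F.yLow x y ⬝ᵥ F.aSpray x y = ∑ n, (F.a x *ᵥ F.aSpray x y) n * y n := by
    rw [F.yLow_dot_comm hx]; rfl
  have h2 : lineDeriv ℝ (fun x' => F.Ssq x' y) x y
      = ∑ n, lineDeriv ℝ (fun x' => F.yLow x' y n) x y * y n := by
    rw [← lineDeriv_sum Finset.univ
      (fun n => (F.contDiffAt_yLow_left hx y n).differentiableAt one_ne_zero) y]
    simp only [← yLow_dot_self]
    rfl
  have h3 := lineDeriv_eq_sum_partialD
    ((F.contDiffAt_Ssq_left hx y).differentiableAt one_ne_zero) y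
  simp only [h1, F.a_mulVec_aSpray hx, sub_mul, Finset.sum_sub_distrib]
  rw [← h2]
  have h4 : ∑ n, 1 / 2 * partialD (fun x' => F.Ssq x' y) n x * y n
      = 1 / 2 * lineDeriv ℝ (fun x' => F.Ssq x' y) x y := by
    rw [h3, Finset.mul_sum]
    exact Finset.sum_congr rfl fun n _ => by ring
  rw [h4]; ring

theorem aChristoffel_symm (hx : x ∈ F.U) (k i j : Fin N) :
    F.aChristoffel x k i j = F.aChristoffel x k j i := by
  have h : ∀ n, partialD (fun x' => F.a x' j i) n x = partialD (fun x' => F.a x' i j) n x := by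
    intro n
    refine Filter.EventuallyEq.lineDeriv_eq ?_
    filter_upwards [F.isOpen_U.mem_nhds hx] with x' hx'
    exact F.a_symm hx' j i
  simp only [aChristoffel, h]
  congr 1
  exact Finset.sum_congr rfl fun n _ => by ring

/-- The connection drops out of the curl of `b_i`, by symmetry of the Christoffel symbols. -/
theorem nablaB_sub (hx : x ∈ F.U) (i j : Fin N) :
    F.nablaB x i j - F.nablaB x j i
      = partialD (fun x' => F.b x' j) i x - partialD (fun x' => F.b x' i) j x := by
  simp only [nablaB, F.aChristoffel_symm hx _ j i]
  ring

theorem lineDeriv_β_left (hx : x ∈ F.U) (d : Fin N → ℝ) :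
    lineDeriv ℝ (fun x' => F.β x' y) x d = ∑ i, lineDeriv ℝ (fun x' => F.b x' i) x d * y i :=
  lineDeriv_sum _ (fun i => (F.contDiffAt_b hx i).differentiableAt one_ne_zero) y

/-- The derivative of `b_n` along `y` differs from the gradient of the scalar `b` by the contracted
curl. -/
theorem lineDeriv_b (hx : x ∈ F.U) (n : Fin N) :
    lineDeriv ℝ (fun x' => F.b x' n) x y
      = F.curlB x y n + partialD (fun x' => F.β x' y) n x := by
  rw [partialD, F.lineDeriv_β_left hx,
    lineDeriv_eq_sum_partialD ((F.contDiffAt_b hx n).differentiableAt one_ne_zero), curlB,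
    ← Finset.sum_add_distrib]
  refine Finset.sum_congr rfl fun i _ => ?_
  rw [F.nablaB_sub hx]
  simp only [partialD]
  ring

/-- The derivative of the scalar `b` along `y`, split into a covariant part and a connection part. -/
theorem lineDeriv_β (hx : x ∈ F.U) :
    lineDeriv ℝ (fun x' => F.β x' y) x y = F.ys x y + F.b x ⬝ᵥ F.aSpray x y := by
  have h : F.b x ⬝ᵥ F.aSpray x y
      = ∑ i, ∑ m, y i * (y m * ∑ k, F.b x k * F.aChristoffel x k i m) := by
    simp only [dotProduct, aSpray, Finset.mul_sum]
    rw [Finset.sum_comm]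
    refine Finset.sum_congr rfl fun i _ => ?_
    rw [Finset.sum_comm]
    exact Finset.sum_congr rfl fun m _ => Finset.sum_congr rfl fun k _ => by ring
  rw [h, F.lineDeriv_β_left hx]
  have h' : F.ys x y = ∑ i, ∑ m, y i * (y m * F.nablaB x i m) := by
    simp only [ys, s, Finset.mul_sum]
  rw [h']
  simp only [nablaB, ← Finset.sum_add_distrib]
  rw [Finset.sum_comm]
  refine Finset.sum_congr rfl fun i _ => ?_
  rw [lineDeriv_eq_sum_partialD ((F.contDiffAt_b hx i).differentiableAt one_ne_zero),
    Finset.sum_mul]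
  exact Finset.sum_congr rfl fun m _ => by ring

theorem dot_curlB (x y : Fin N → ℝ) : y ⬝ᵥ F.curlB x y = 0 := by
  have h : y ⬝ᵥ F.curlB x y = ∑ j, ∑ i, y j * (y i * (F.nablaB x i j - F.nablaB x j i)) := by
    simp only [dotProduct, curlB, Finset.mul_sum]
  have h' : y ⬝ᵥ F.curlB x y = -(y ⬝ᵥ F.curlB x y) := by
    conv_lhs => rw [h, Finset.sum_comm]
    rw [h, ← Finset.sum_neg_distrib]
    refine Finset.sum_congr rfl fun i _ => ?_
    rw [← Finset.sum_neg_distrib]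
    exact Finset.sum_congr rfl fun j _ => by ring
  linarith

/-! ### The spray -/

/-- The spray is the Euler–Lagrange covector of `K²` with its index raised. -/
theorem spray_eq_mulVec (hx : x ∈ F.U) (hq : 0 < F.q x y) :
    spray F.K x y = metricInv F.K x y *ᵥ fun n =>
      lineDeriv ℝ (fun x' => (metric F.K x' y *ᵥ y) n) x y
        - 1 / 2 * partialD (fun x' => (metric F.K x' y *ᵥ y) ⬝ᵥ y) n x := by
  ext k
  exact sum_christoffel (m := fun x' => metric F.K x' y)
    (fun i j => (F.contDiffAt_metric_left hx hq i j).differentiableAt one_ne_zero)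
    (metricInv F.K x y k) y

theorem E_eq (x y : Fin N → ℝ) :
    F.E x y = (F.M x y * F.yg x y) • y
      + (1 / 2 * F.K x y ^ 2 * F.yg x y) •
        (metricInv F.K x y *ᵥ fun i => partialD (fun y' => F.M x y') i y)
      - (1 / 2 * F.M x y * F.K x y ^ 2) • (metricInv F.K x y *ᵥ F.gradG x) := by
  ext k
  simp only [E, gradGUp, Pi.add_apply, Pi.sub_apply, Pi.smul_apply, smul_eq_mul, mulVec,
    dotProduct]
  simp only [mul_comm (metricInv F.K x y k _)]

/-- The vector `vⁱ` lowered with the Finsleroid metric tensor. -/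
theorem metric_mulVec_vUp (hx : x ∈ F.U) (hq : 0 < F.q x y) (n : Fin N) :
    (metric F.K x y *ᵥ F.vUp x y) n = F.W x y / F.B x y *
      ((F.β x y ^ 2 + F.q x y ^ 2) * F.vLow x y n + F.g x * F.q x y ^ 3 * F.b x n) := by
  have hB := (F.B_pos hx hq).ne'
  have hBe : F.B x y = F.β x y ^ 2 + F.g x * F.β x y * F.q x y + F.q x y ^ 2 := rfl
  rw [F.metric_mulVec hx hq, F.a_mulVec_vUp hx, F.b_dot_vUp hx, F.vLow_dot_vUp hx hq]
  generalize F.B x y = B at *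
  field_simp
  rw [hBe]
  ring

theorem yg_eq (hx : x ∈ F.U) : F.yg x y = lineDeriv ℝ F.g x y :=
  (lineDeriv_eq_sum_partialD ((F.contDiffAt_g hx).differentiableAt one_ne_zero) y).symm

/-- The spray in vector form; the two terms along `vⁱ` use `p bⁱ + r yⁱ = r vⁱ`. Both sides are compared
after lowering the index. -/
theorem spray_eq (hx : x ∈ F.U) (hq : 0 < F.q x y) :
    spray F.K x y = (F.g x * F.q x y) • (F.aInv x *ᵥ F.curlB x y)
      + (F.g x * F.q x y * (F.bUp x ⬝ᵥ F.curlB x y) * F.r x y) • F.vUp x y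
      + (F.g x / F.q x y * F.ys x y) • F.vUp x y + F.aSpray x y + F.E x y := by
  have hB := (F.B_pos hx hq).ne'
  have hBe : F.B x y = F.β x y ^ 2 + F.g x * F.β x y * F.q x y + F.q x y ^ 2 := rfl
  rw [F.spray_eq_mulVec hx hq, ← F.metricInv_mulVec_metric_mulVec hx hq
    ((F.g x * F.q x y) • (F.aInv x *ᵥ F.curlB x y)
      + (F.g x * F.q x y * (F.bUp x ⬝ᵥ F.curlB x y) * F.r x y) • F.vUp x y
      + (F.g x / F.q x y * F.ys x y) • F.vUp x y + F.aSpray x y + F.E x y)]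
  congr 1
  ext n
  have ho : F.b x ⬝ᵥ (F.aInv x *ᵥ F.curlB x y) = F.bUp x ⬝ᵥ F.curlB x y := by
    rw [dotProduct_mulVec, F.b_vecMul_aInv hx]
  have hvo : F.vLow x y ⬝ᵥ (F.aInv x *ᵥ F.curlB x y)
      = -(F.β x y * (F.bUp x ⬝ᵥ F.curlB x y)) := by
    rw [dotProduct_mulVec, F.vLow_vecMul_aInv hx, vUp_eq, sub_dotProduct, smul_dotProduct,
      F.dot_curlB, smul_eq_mul]
    ring
  have hvc : F.vLow x y ⬝ᵥ F.aSpray x y = 1 / 2 * lineDeriv ℝ (fun x' => F.Ssq x' y) x y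
      - F.β x y * (F.b x ⬝ᵥ F.aSpray x y) := by
    rw [vLow_dot, F.yLow_dot_aSpray hx]
  have hu : F.yLow x y n = F.vLow x y n + F.β x y * F.b x n := by simp [vLow]
  -- every lowered term becomes a combination of `b_n`, `v_n`, the curl, the Riemannian
  -- Euler–Lagrange covector and the gradient of the charge
  rw [E_eq]
  simp only [mulVec_add, mulVec_sub, mulVec_smul, F.metric_mulVec_metricInv_mulVec hx hq,
    Pi.add_apply, Pi.sub_apply, Pi.smul_apply, smul_eq_mul, F.metric_mulVec_vUp hx hq,
    F.metric_mulVec_self hx hq]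
  rw [F.metric_mulVec hx hq (F.aInv x *ᵥ F.curlB x y), F.metric_mulVec hx hq (F.aSpray x y),
    F.a_mulVec_aSpray hx, mulVec_mulVec, F.a_mul_aInv hx, one_mulVec, ho, hvo, hvc,
    F.partialD_metric_dot hx hq, F.lineDeriv_metric_mulVec hx hq, F.lineDeriv_b hx,
    F.lineDeriv_β hx, F.partialD_M hx hq, F.K_sq hx hq, F.yg_eq hx, hu, r]
  generalize F.B x y = B at *
  generalize F.q x y = q at *
  generalize F.β x y = β at *
  generalize F.W x y = W at *
  field_simp
  rw [hBe]
  ring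

/-! ### The Cartan vector -/

/-- Raising an index with the inverse metric tensor, up to the factor `W⁻¹`. -/
theorem metricInvForm_mulVec (x y z : Fin N → ℝ) (i : Fin N) :
    (F.metricInvForm x y *ᵥ z) i = (F.aInv x *ᵥ z) i
      + F.g x / F.B x y * ((-(F.β x y * F.q x y * (F.bUp x ⬝ᵥ z))
          - F.q x y * (F.vUp x y ⬝ᵥ z)) * F.bUp x i
        + (-(F.q x y * (F.bUp x ⬝ᵥ z))
          + (F.β x y + F.g x * F.q x y) / F.q x y * (F.vUp x y ⬝ᵥ z)) * F.vUp x y i) := by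
  rw [metricInvForm, perturbed_mulVec]
  ring

theorem aInv_mulVec_vLow (hx : x ∈ F.U) : F.aInv x *ᵥ F.vLow x y = F.vUp x y := by
  rw [← F.a_mulVec_vUp hx, mulVec_mulVec, F.aInv_mul_a hx, one_mulVec]

theorem metricInvForm_mulVec_b (hx : x ∈ F.U) (hq : 0 < F.q x y) :
    F.metricInvForm x y *ᵥ F.b x = ((F.β x y ^ 2 + F.q x y ^ 2) / F.B x y) • F.bUp x
      - (F.g x * F.q x y / F.B x y) • F.vUp x y := by
  have hB := (F.B_pos hx hq).ne'
  have hBe : F.B x y = F.β x y ^ 2 + F.g x * F.β x y * F.q x y + F.q x y ^ 2 := rfl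
  ext i
  rw [F.metricInvForm_mulVec, dotProduct_comm (F.bUp x), F.b_dot_bUp hx,
    dotProduct_comm (F.vUp x y), F.b_dot_vUp hx, ← bUp_eq]
  simp only [Pi.sub_apply, Pi.smul_apply, smul_eq_mul]
  generalize F.B x y = B at *
  field_simp
  rw [hBe]
  ring

theorem metricInvForm_mulVec_vLow (hx : x ∈ F.U) (hq : 0 < F.q x y) :
    F.metricInvForm x y *ᵥ F.vLow x y = -(F.g x * F.q x y ^ 3 / F.B x y) • F.bUp x
      + (((F.β x y + F.g x * F.q x y) ^ 2 + F.q x y ^ 2) / F.B x y) • F.vUp x y := by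
  have hB := (F.B_pos hx hq).ne'
  have hBe : F.B x y = F.β x y ^ 2 + F.g x * F.β x y * F.q x y + F.q x y ^ 2 := rfl
  ext i
  rw [F.metricInvForm_mulVec, dotProduct_comm (F.bUp x), F.vLow_dot_bUp hx,
    dotProduct_comm (F.vUp x y), F.vLow_dot_vUp hx hq, F.aInv_mulVec_vLow hx]
  simp only [Pi.add_apply, Pi.smul_apply, smul_eq_mul]
  generalize F.B x y = B at *
  field_simp
  rw [hBe]
  ring

theorem metricInvForm_transpose (hx : x ∈ F.U) :
    (F.metricInvForm x y)ᵀ = F.metricInvForm x y := by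
  ext i j
  have : F.aInv x j i = F.aInv x i j := congrFun (congrFun (F.aInv_transpose hx) i) j
  rw [transpose_apply, metricInvForm, perturbed_apply, perturbed_apply, this]
  ring

theorem a_mulVec_single (x : Fin N → ℝ) (j : Fin N) (i : Fin N) :
    F.yLow x (Pi.single j 1) i = F.a x i j := by simp [yLow]

theorem sum_metricInvForm_mul (hx : x ∈ F.U) (z w : Fin N → ℝ) :
    ∑ i, ∑ j, F.metricInvForm x y i j * (z i * w j) = (F.metricInvForm x y *ᵥ z) ⬝ᵥ w := by
  have h : (F.metricInvForm x y *ᵥ z) ⬝ᵥ w = (F.metricInvForm x y *ᵥ w) ⬝ᵥ z := by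
    rw [dotProduct_comm, dotProduct_mulVec, ← mulVec_transpose, F.metricInvForm_transpose hx]
  rw [h]
  simp only [dotProduct, mulVec, Finset.sum_mul]
  exact Finset.sum_congr rfl fun i _ => Finset.sum_congr rfl fun j _ => by ring

/-- The derivative `∂v_i/∂yᵏ = a_{ik} - b_i b_k`. -/
def vDeriv (x : Fin N → ℝ) (k : Fin N) (i : Fin N) : ℝ := F.a x i k - F.b x k * F.b x i

theorem hasLineDerivAt_vLow_right (x y : Fin N → ℝ) (i k : Fin N) :
    HasLineDerivAt ℝ (fun y' => F.vLow x y' i) (F.vDeriv x k i) y (Pi.single k 1) := by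
  have h := HasDerivAt.sub (F.hasLineDerivAt_yLow_right x y (Pi.single k 1) i)
    (HasDerivAt.mul_const (F.hasLineDerivAt_β_right x y (Pi.single k 1)) (F.b x i))
  rw [F.a_mulVec_single, dotProduct_single_one] at h
  exact h

theorem vDeriv_dot_bUp (hx : x ∈ F.U) (k : Fin N) : F.bUp x ⬝ᵥ F.vDeriv x k = 0 := by
  have h : F.vDeriv x k = F.yLow x (Pi.single k 1) - F.b x k • F.b x := by
    ext i; simp [vDeriv, yLow]
  rw [h, dotProduct_comm, sub_dotProduct, smul_dotProduct, F.b_dot_bUp hx, F.yLow_dot_bUp hx, β_eq,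
    dotProduct_single_one]
  simp

theorem vDeriv_dot_vUp (hx : x ∈ F.U) (k : Fin N) : F.vUp x y ⬝ᵥ F.vDeriv x k = F.vLow x y k := by
  have h : F.vDeriv x k = F.yLow x (Pi.single k 1) - F.b x k • F.b x := by
    ext i; simp [vDeriv, yLow]
  rw [h, dotProduct_comm, sub_dotProduct, smul_dotProduct, F.b_dot_vUp hx, F.yLow_dot_comm hx]
  change (F.a x *ᵥ F.vUp x y) ⬝ᵥ _ - _ = _
  rw [F.a_mulVec_vUp hx, dotProduct_single_one, smul_zero, sub_zero]

/-- The determinant of `g_{ij}` is `W^N det a`, so that its logarithmic derivative, the trace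
`g^{ij} ∂g_{ij}/∂yᵏ`, is `N` times that of `W`. -/
theorem sum_metricInv_mul_partialD (hx : x ∈ F.U) (hq : 0 < F.q x y) (k : Fin N) :
    ∑ i, ∑ j, metricInv F.K x y i j * partialD (fun y' => metric F.K x y' i j) k y
      = N * (F.g x / (F.q x y * F.B x y)
        * (F.q x y ^ 2 * F.b x k - F.β x y * F.vLow x y k)) := by
  have hB := (F.B_pos hx hq).ne'
  have hW := (F.W_pos x y).ne'
  have hBe : F.B x y = F.β x y ^ 2 + F.g x * F.β x y * F.q x y + F.q x y ^ 2 := rfl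
  have dβ := F.hasLineDerivAt_β_right x y (Pi.single k 1)
  have dκ := F.hasLineDerivAt_q_right hx hq (Pi.single k 1)
  have dW := F.hasLineDerivAt_W_right hx hq (Pi.single k 1)
  have dB := hasLineDerivAt_quad (hasLineDerivAt_const (F.g x) y (Pi.single k 1)) dβ dκ
  have dgB := HasDerivAt.div (hasDerivAt_const (0 : ℝ) (F.g x)) dB (by
    simpa only [zero_smul, add_zero, ← B_eq] using hB)
  have d₁ := HasDerivAt.mul dgB (HasDerivAt.mul dκ (HasDerivAt.add dβ
    (HasDerivAt.const_mul (F.g x) dκ)))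
  have d₂ := HasDerivAt.mul dgB dκ
  have d₃ := (HasDerivAt.mul dgB (HasDerivAt.div dβ dκ (by
    simpa only [zero_smul, add_zero] using hq.ne'))).neg
  simp only [Pi.add_apply, Pi.mul_apply, Pi.div_apply, zero_smul, add_zero,
    dotProduct_single_one, ← B_eq] at d₁ d₂ d₃ dW
  obtain ⟨c₁', e₁, d₁⟩ : ∃ c, c = _ ∧ HasLineDerivAt ℝ (fun y' => F.g x / F.B x y'
    * (F.q x y' * (F.β x y' + F.g x * F.q x y'))) c y (Pi.single k 1) := ⟨_, rfl, d₁⟩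
  obtain ⟨c₂', e₂, d₂⟩ : ∃ c, c = _ ∧ HasLineDerivAt ℝ (fun y' => F.g x / F.B x y' * F.q x y')
    c y (Pi.single k 1) := ⟨_, rfl, d₂⟩
  obtain ⟨c₃', e₃, d₃⟩ : ∃ c, c = _ ∧ HasLineDerivAt ℝ
    (fun y' => -(F.g x / F.B x y' * (F.β x y' / F.q x y'))) c y (Pi.single k 1) := ⟨_, rfl, d₃⟩
  obtain ⟨W', eW, dW⟩ : ∃ c, c = _ ∧ HasLineDerivAt ℝ (F.W x) c y (Pi.single k 1) :=
    ⟨_, rfl, dW⟩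
  clear dgB dB dβ dκ
  -- the primed coefficients stay opaque until all contractions with the inverse are done
  have d : ∀ i j, partialD (fun y' => metric F.K x y' i j) k y =
      W' / F.W x y * metric F.K x y i j + F.W x y * (c₁' * (F.b x i * F.b x j)
        + c₂' * (F.b x i * F.vLow x y j + F.vLow x y i * F.b x j)
        + c₃' * (F.vLow x y i * F.vLow x y j)
        + F.g x / F.B x y * F.q x y * (F.b x i * F.vDeriv x k j + F.vDeriv x k i * F.b x j)
        + -(F.g x / F.B x y * (F.β x y / F.q x y))
          * (F.vDeriv x k i * F.vLow x y j + F.vLow x y i * F.vDeriv x k j)) := by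
    intro i j
    have e : (fun y' => metric F.K x y' i j) =ᶠ[𝓝 y] fun y' => F.W x y' * (F.a x i j
        + (F.g x / F.B x y' * (F.q x y' * (F.β x y' + F.g x * F.q x y'))) * (F.b x i * F.b x j)
        + (F.g x / F.B x y' * F.q x y') * (F.b x i * F.vLow x y' j + F.vLow x y' i * F.b x j)
        + (-(F.g x / F.B x y' * (F.β x y' / F.q x y'))) * (F.vLow x y' i * F.vLow x y' j)) := by
      filter_upwards [F.eventually_q_pos_right hq] with y' hq'
      rw [F.metric_eq hx hq']; rfl
    have di := F.hasLineDerivAt_vLow_right x y i k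
    have dj := F.hasLineDerivAt_vLow_right x y j k
    have h := HasDerivAt.mul dW (((HasDerivAt.const_add (F.a x i j)
      (HasDerivAt.mul_const d₁ (F.b x i * F.b x j))).add
      (HasDerivAt.mul d₂ ((HasDerivAt.const_mul (F.b x i) dj).add
        (HasDerivAt.mul_const di (F.b x j))))).add (HasDerivAt.mul d₃ (HasDerivAt.mul di dj)))
    rw [partialD, e.lineDeriv_eq]
    refine h.deriv.trans ?_
    rw [F.metric_eq hx hq]
    simp only [Pi.add_apply, Pi.mul_apply, zero_smul, add_zero, Matrix.smul_apply, metricForm,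
      perturbed_apply, smul_eq_mul]
    rw [← mul_assoc (W' / F.W x y), div_mul_cancel₀ W' hW]
    ring
  have tr : ∑ i, ∑ j, metricInv F.K x y i j * metric F.K x y i j = N := by
    have h1 : (metricInv F.K x y * metric F.K x y).trace = N := by
      rw [metricInv, Matrix.nonsing_inv_mul _ (F.isUnit_det_metric hx hq), trace_one,
        Fintype.card_fin]
    rw [← h1]
    simp only [trace, diag_apply, mul_apply]
    refine Finset.sum_congr rfl fun i _ => Finset.sum_congr rfl fun j _ => ?_
    rw [F.metric_eq hx hq, Matrix.smul_apply, Matrix.smul_apply, metricForm, perturbed_apply,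
      perturbed_apply, F.a_symm hx i j]
    ring
  -- apart from the factor `W`, only contractions of `b`, `v` and `∂v` with the inverse remain
  have split : ∀ i j, metricInv F.K x y i j * partialD (fun y' => metric F.K x y' i j) k y
      = W' / F.W x y * (metricInv F.K x y i j * metric F.K x y i j)
        + (c₁' * (F.metricInvForm x y i j * (F.b x i * F.b x j))
        + c₂' * (F.metricInvForm x y i j * (F.b x i * F.vLow x y j))
        + c₂' * (F.metricInvForm x y i j * (F.vLow x y i * F.b x j))
        + c₃' * (F.metricInvForm x y i j * (F.vLow x y i * F.vLow x y j))
        + F.g x / F.B x y * F.q x y * (F.metricInvForm x y i j * (F.b x i * F.vDeriv x k j))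
        + F.g x / F.B x y * F.q x y * (F.metricInvForm x y i j * (F.vDeriv x k i * F.b x j))
        + -(F.g x / F.B x y * (F.β x y / F.q x y))
          * (F.metricInvForm x y i j * (F.vDeriv x k i * F.vLow x y j))
        + -(F.g x / F.B x y * (F.β x y / F.q x y))
          * (F.metricInvForm x y i j * (F.vLow x y i * F.vDeriv x k j))) := by
    intro i j
    have hm : F.W x y * metricInv F.K x y i j = F.metricInvForm x y i j := by
      rw [F.metricInv_eq hx hq, Matrix.smul_apply, smul_eq_mul, mul_inv_cancel_left₀ hW]
    rw [d i j, ← hm]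
    ring
  have symm : ∀ z w : Fin N → ℝ, (F.metricInvForm x y *ᵥ z) ⬝ᵥ w
      = (F.metricInvForm x y *ᵥ w) ⬝ᵥ z := fun z w => by
    rw [dotProduct_comm, dotProduct_mulVec, ← mulVec_transpose, F.metricInvForm_transpose hx]
  simp only [split, Finset.sum_add_distrib, ← Finset.mul_sum, tr, F.sum_metricInvForm_mul hx]
  rw [symm (F.vDeriv x k), symm (F.vDeriv x k), F.metricInvForm_mulVec_b hx hq,
    F.metricInvForm_mulVec_vLow hx hq]
  simp only [add_dotProduct, sub_dotProduct, smul_dotProduct, F.vDeriv_dot_bUp hx,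
    F.vDeriv_dot_vUp hx, dotProduct_comm (F.bUp x) (F.b x), dotProduct_comm (F.vUp x y) (F.b x),
    dotProduct_comm (F.bUp x) (F.vLow x y), dotProduct_comm (F.vUp x y) (F.vLow x y),
    F.b_dot_bUp hx, F.b_dot_vUp hx, F.vLow_dot_bUp hx, F.vLow_dot_vUp hx hq, smul_eq_mul]
  rw [eW, e₁, e₂, e₃]
  generalize F.B x y = B at *
  generalize F.q x y = q at *
  generalize F.β x y = β at *
  generalize F.W x y = W at *
  field_simp
  rw [hBe]
  ring

/-- The Cartan covector `A_k`. -/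
theorem cartanLow_eq (hx : x ∈ F.U) (hq : 0 < F.q x y) (k : Fin N) :
    cartanLow F.K x y k = F.K x y / 2 * (N * (F.g x / (F.q x y * F.B x y)
        * (F.q x y ^ 2 * F.b x k - F.β x y * F.vLow x y k))) := by
  rw [← F.sum_metricInv_mul_partialD hx hq k]
  simp only [cartanLow, cartan, Finset.mul_sum]
  exact Finset.sum_congr rfl fun i _ => Finset.sum_congr rfl fun j _ => by ring

/-! ### The charge-gradient part of the spray -/

theorem partialD_M_eq (hx : x ∈ F.U) (hq : 0 < F.q x y) :
    (fun i => partialD (fun y' => F.M x y') i y) = (2 * F.q x y / F.B x y ^ 2) •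
      (F.q x y ^ 2 • F.b x - F.β x y • F.vLow x y) := by
  ext i
  rw [F.partialD_M hx hq]
  simp

/-- The fibre gradient of `M` and the Cartan vector are both multiples of this vector. -/
theorem metricInv_mulVec_fibreDirection (hx : x ∈ F.U) (hq : 0 < F.q x y) :
    metricInv F.K x y *ᵥ (F.q x y ^ 2 • F.b x - F.β x y • F.vLow x y)
      = (F.W x y)⁻¹ • (F.B x y • F.bUp x - (F.β x y + F.g x * F.q x y) • y) := by
  have hB := (F.B_pos hx hq).ne'
  have hBe : F.B x y = F.β x y ^ 2 + F.g x * F.β x y * F.q x y + F.q x y ^ 2 := rfl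
  rw [F.metricInv_eq hx hq, smul_mulVec, mulVec_sub, mulVec_smul, mulVec_smul,
    F.metricInvForm_mulVec_b hx hq, F.metricInvForm_mulVec_vLow hx hq]
  congr 1
  ext i
  have hyi : y i = F.vUp x y i + F.β x y * F.bUp x i := by simp [vUp]
  simp only [Pi.add_apply, Pi.sub_apply, Pi.smul_apply, smul_eq_mul, hyi]
  generalize F.B x y = B at *
  generalize F.q x y = q at *
  generalize F.β x y = β at *
  generalize F.vUp x y i = v at *
  field_simp
  rw [hBe]
  ring

theorem cartanUp_eq (hx : x ∈ F.U) (hq : 0 < F.q x y) :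
    cartanUp F.K x y = (F.K x y / 2 * N * (F.g x / (F.q x y * F.B x y))) •
      (metricInv F.K x y *ᵥ (F.q x y ^ 2 • F.b x - F.β x y • F.vLow x y)) := by
  rw [← mulVec_smul]
  ext k
  simp only [cartanUp, mulVec, dotProduct]
  refine Finset.sum_congr rfl fun j _ => ?_
  rw [F.cartanLow_eq hx hq]
  simp only [Pi.smul_apply, Pi.sub_apply, smul_eq_mul]
  ring

theorem gradGUp_eq (x y : Fin N → ℝ) :
    F.gradGUp x y = metricInv F.K x y *ᵥ F.gradG x := by
  ext k
  exact Finset.sum_congr rfl fun i _ => mul_comm _ _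

end FinsleroidSpace

end

theorem theoremB1 {N : ℕ} (F : FinsleroidSpace N) (x : Fin N → ℝ) (hx : x ∈ F.U)
    (y : Fin N → ℝ) (hq : 0 < F.q x y) :
    -- the spray coefficients are well defined at `(x, y)`
    (ContDiffAt ℝ (⊤ : ℕ∞) (fun y' => F.K x y' ^ 2) y ∧
      (∀ i j, DifferentiableAt ℝ (fun x' => FinslerLocal.metric F.K x' y i j) x) ∧
      IsUnit (FinslerLocal.metric F.K x y).det) ∧
    -- their explicit form
    (∀ k, FinslerLocal.spray F.K x y k =
      F.g x * F.q x y *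
          (∑ j, (F.aInv x k j + (F.p x y * F.bUp x k + F.r x y * y k) * F.bUp x j) *
            ∑ i, y i * (F.nablaB x i j - F.nablaB x j i))
        + F.g x / F.q x y * (y k - F.β x y * F.bUp x k) * F.ys x y
        + (∑ m, ∑ n, F.aChristoffel x k m n * y m * y n)
        + F.E x y k) ∧
    -- the explicit form of `E` through the Cartan vector, wherever `g` does not vanish
    (F.g x ≠ 0 → ∀ k, F.E x y k =
      F.M x y * F.yg x y * y k
        + F.K x y * (2 * F.q x y ^ 2 / (F.g x * N * F.B x y)) * F.yg x y *
            FinslerLocal.cartanUp F.K x y k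
        - 1 / 2 * F.M x y * F.K x y ^ 2 * F.gradGUp x y k) ∧
    -- the same form with the Cartan vector written out, for every value of `g`
    (∀ k, F.E x y k =
      F.M x y * F.yg x y * y k
        + F.q x y / F.B x y * F.yg x y *
            (F.B x y * F.bUp x k - (F.β x y + F.g x * F.q x y) * y k)
        - 1 / 2 * F.M x y * F.K x y ^ 2 * F.gradGUp x y k) := by
  open Matrix in
  -- in dimension zero `q` vanishes identically
  have hN : (N : ℝ) ≠ 0 := by
    rintro h
    obtain rfl : N = 0 := by exact_mod_cast h
    simp [FinsleroidSpace.q, FinsleroidSpace.Ssq, FinsleroidSpace.β] at hq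
  have hB := (F.B_pos hx hq).ne'
  have hW := (F.W_pos x y).ne'
  refine ⟨⟨F.contDiffAt_K_sq hx hq, fun i j =>
    (F.contDiffAt_metric_left hx hq i j).differentiableAt one_ne_zero,
    F.isUnit_det_metric hx hq⟩, fun k => ?_, fun hg k => ?_, fun k => ?_⟩
  · have h1 : ∑ j, (F.aInv x k j + (F.p x y * F.bUp x k + F.r x y * y k) * F.bUp x j) *
        ∑ i, y i * (F.nablaB x i j - F.nablaB x j i)
        = (F.aInv x *ᵥ F.curlB x y) k
          + (F.bUp x ⬝ᵥ F.curlB x y) * F.r x y * F.vUp x y k := by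
      simp only [add_mul, Finset.sum_add_distrib, mul_assoc, ← Finset.mul_sum]
      have h2 : (F.bUp x ⬝ᵥ F.curlB x y) = ∑ j, F.bUp x j *
        ∑ i, y i * (F.nablaB x i j - F.nablaB x j i) := rfl
      rw [h2]
      simp only [FinsleroidSpace.p, FinsleroidSpace.vUp]
      change (F.aInv x *ᵥ F.curlB x y) k + _ = _
      ring
    rw [h1, F.spray_eq hx hq]
    simp only [Pi.add_apply, Pi.smul_apply, smul_eq_mul, FinsleroidSpace.aSpray,
      FinsleroidSpace.vUp]
    ring
  · rw [F.E_eq, F.partialD_M_eq hx hq, F.cartanUp_eq hx hq, F.gradGUp_eq, mulVec_smul]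
    simp only [Pi.add_apply, Pi.sub_apply, Pi.smul_apply, smul_eq_mul]
    have := hq.ne'
    field_simp
  · rw [F.E_eq, F.partialD_M_eq hx hq, F.gradGUp_eq, mulVec_smul,
      F.metricInv_mulVec_fibreDirection hx hq, F.K_sq hx hq]
    simp only [Pi.add_apply, Pi.sub_apply, Pi.smul_apply, smul_eq_mul]
    field_simp
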